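/- Let $k\ge 1$ and let $\Lambda$ be a finite $k$-graph (each $\Lambda^p=d^{-1}(p)$, $p\in\mathbb N^k$, is finite) that is strongly connected ($v\Lambda w\neq\emptyset$ for all $v,w\in\Lambda^0$) and has no sources ($v\Lambda^p\ne\emptyset$ for all $v\in\Lambda^0$, $p\in\mathbb N^k$); write $r,s,d$ for the range, source and degree maps. Let $G$ be a groupoid with unit space $\Lambda^0$ that acts faithfully on $\Lambda$ by partial isomorphisms: each $g\in G$ gives a degree-preserving bijection $\lambda\mapsto g\cdot\lambda$ of $\operatorname{dom}(g)\Lambda$ onto $\operatorname{cod}(g)\Lambda$ with $g\cdot(\lambda e)\in (g\cdot\lambda)\Lambda$ for all $\lambda\in\operatorname{dom}(g)\Lambda$ and all edges $e\in s(\lambda)\Lambda$. Suppose that the action is self-similar: for every $g\in G$ and every edge $e\in\operatorname{dom}(g)\Lambda$ there is $h\in G$ with $g\cdot(e\lambda)=(g\cdot e)(h\cdot\lambda)$ for all $\lambda\in s(e)\Lambda$. Then for every $\lambda\in\operatorname{dom}(g)\Lambda$ there is a unique $g|_\lambda\in G$ with $g\cdot(\lambda\mu)=(g\cdot\lambda)(g|_\lambda\cdot\mu)$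 for all $\mu\in s(\lambda)\Lambda$. Suppose that the action is finite-state: $\{g|_\lambda:\lambda\in\operatorname{dom}(g)\Lambda\}$ is finite for every $g\in G\setminus\Lambda^0$. Let $\Lambda^\infty$ be the space of infinite paths (degree-preserving functors $x:\Omega_k\to\Lambda$), with the topology generated by the cylinder sets $Z(\lambda)=\{\lambda y\}$, the shifts $\sigma^n(x)(p,q)=x(p+n,q+n)$ and the action $(g\cdot x)(p,q)=g|_{x(0,p)}\cdot x(p,q)$. Let $B_i(v,w)=|v\Lambda^{e_i}w|$ be the adjacency matrices, $\rho(B_i)$ their spectral radii, and $\rho(\Lambda)^p=\prod_i\rho(B_i)^{p_i}$. Let $x_\Lambda\in(0,\infty)^{\Lambda^0}$ be the unimodular Perron--Frobenius eigenvector (the unique vector of unit $1$-norm with $B_ix_\Lambda=\rho(B_i)x_\Lambda$ for all $i$), and let $M$ be the Perron--Frobenius measure (the unique Borel probability measure on $\Lambda^\infty$ with $M(Z(\lambda))=\rho(\Lambda)^{-d(\lambda)}x_\Lambda(s(\lambda))$ for all $\lambda\in\Lambda$). Let $\operatorname{Per}(G,\Lambda)$ be the set of all $p-q\in\mathbb Z^k$,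 where $p,q\in\mathbb N^k$ are such that for some $g\in G$ we have $\sigma^p(x)=\sigma^q(g\cdot x)$ for all $x\in\operatorname{dom}(g)\Lambda^\infty$. For $p-q\in\operatorname{Per}(G,\Lambda)$ and $\lambda\in\Lambda^p$ let $(\theta_{p,q}(\lambda),h_{p,q}(\lambda))\in\Lambda^q\times G$ be the unique pair with $\lambda(h_{p,q}(\lambda)\cdot x)=\theta_{p,q}(\lambda)x$ for all $x\in\operatorname{dom}(h_{p,q}(\lambda))\Lambda^\infty$. For $g\in G$ with the same domain and codomain as $h=h_{p,q}(\lambda)$ but $g\ne h$, put, with $N=(1,\dots,1)$, \[ c^l_{p,q,\lambda}(g)=\rho(\Lambda)^{-lN}\sum_{v\in\Lambda^0}\bigl|\{\nu\in\operatorname{dom}(g)\Lambda^{lN}v:\ g\cdot\nu=h\cdot\nu,\ g|_\nu=h|_\nu\}\bigr|\,x_\Lambda(v), \qquad c_{p,q,\lambda}(g)=\lim_{l\to\infty}c^l_{p,q,\lambda}(g). \] Then for all $\lambda,\mu\in\Lambda$ and $g\in G$ with $\operatorname{dom}(g)=s(\mu)$ and $\operatorname{cod}(g)=s(\lambda)$,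 the set \[ Z(\lambda,g,\mu)=\{x\in\Lambda^\infty:\ x=\lambda(g\cdot y)=\mu y\text{ for some }y\in\Lambda^\infty\} \] satisfies \[ M\bigl(Z(\lambda,g,\mu)\bigr)= \begin{cases} \rho(\Lambda)^{-d(\mu)}x_\Lambda(s(\mu)) & \text{if } d(\lambda)-d(\mu)\in\operatorname{Per}(G,\Lambda),\ \mu=\theta_{d(\lambda),d(\mu)}(\lambda),\ g=h_{d(\lambda),d(\mu)}(\lambda),\\ \rho(\Lambda)^{-d(\mu)}c_{d(\lambda),d(\mu),\lambda}(g) & \text{if } d(\lambda)-d(\mu)\in\operatorname{Per}(G,\Lambda),\ \mu=\theta_{d(\lambda),d(\mu)}(\lambda),\ g\neq h_{d(\lambda),d(\mu)}(\lambda),\\ 0 & \text{otherwise,} \end{cases} \] where in the second case the limit that defines $c_{d(\lambda),d(\mu),\lambda}(g)$ exists. -/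

import Mathlib

open CategoryTheory MeasureTheory Filter Topology

universe u v w

/-- A `k`-graph with vertex set `V` and set of paths (morphisms) `P`: a small category, written in
terms of its set of morphisms, with a degree functor to `ℕ^k` that satisfies the factorisation
property. The composite `comp a b` is the paper-order product `a b`, defined when the source of `a`
is the range of `b`; `one v` is the identity morphism at `v`. -/
structure KGraph (k : ℕ) (V : Type u) (P : Type v) where
  rng : P → V
  src : P → V
  deg : P → (Fin k → ℕ)
  one : V → P
  comp : (a b : P) → src a = rng b → P
  rng_one : ∀ x, rng (one x) = x
  src_one : ∀ x, src (one x) = x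
  rng_comp : ∀ a b h, rng (comp a b h) = rng a
  src_comp : ∀ a b h, src (comp a b h) = src b
  one_comp : ∀ a, comp (one (rng a)) a (src_one _) = a
  comp_one : ∀ a, comp a (one (src a)) (rng_one _).symm = a
  assoc : ∀ a b c (h₁ : src a = rng b) (h₂ : src b = rng c),
    comp (comp a b h₁) c ((src_comp a b h₁).trans h₂)
      = comp a (comp b c h₂) (h₁.trans (rng_comp b c h₂).symm)
  deg_one : ∀ x, deg (one x) = 0
  deg_comp : ∀ a b h, deg (comp a b h) = deg a + deg b
  factorisation : ∀ a m n, deg a = m + n →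
    ∃! bc : P × P, deg bc.1 = m ∧ deg bc.2 = n ∧ ∃ h, comp bc.1 bc.2 h = a

namespace KGraph

variable {k : ℕ} {V : Type u} {P : Type v} (Λ : KGraph k V P)

/-- `Λ` is finite: every `Λ^p` is finite. -/
def IsFinite : Prop := ∀ p, {a | Λ.deg a = p}.Finite

/-- `v Λ w` is non-empty for all vertices `v`, `w`. -/
def IsStronglyConnected : Prop := ∀ x y : V, ∃ a, Λ.rng a = x ∧ Λ.src a = y

/-- `v Λ^p` is non-empty for all vertices `v` and all `p ∈ ℕ^k`. -/
def HasNoSources : Prop := ∀ (x : V) (p : Fin k → ℕ), ∃ a, Λ.rng a = x ∧ Λ.deg a = p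

/-- An edge: a path whose degree is one of the standard generators of `ℕ^k`. -/
def IsEdge (a : P) : Prop := ∃ i : Fin k, Λ.deg a = Pi.single i 1

section
variable {Λ}

theorem comp_left_cancel {a b b' : P} (h : Λ.src a = Λ.rng b) (h' : Λ.src a = Λ.rng b')
    (e : Λ.comp a b h = Λ.comp a b' h') : b = b' := by
  have hd : Λ.deg b = Λ.deg b' := by
    have := congrArg Λ.deg e
    rw [Λ.deg_comp, Λ.deg_comp] at this
    exact add_left_cancel this
  obtain ⟨_, _, hu⟩ := Λ.factorisation (Λ.comp a b h) _ _ (Λ.deg_comp a b h)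
  have h1 := hu (a, b) ⟨rfl, rfl, h, rfl⟩
  have h2 := hu (a, b') ⟨rfl, hd.symm, h', e.symm⟩
  exact congrArg Prod.snd (h1.trans h2.symm)

theorem eq_one_of_deg_eq_zero {a : P} (h : Λ.deg a = 0) : a = Λ.one (Λ.rng a) := by
  obtain ⟨_, _, hu⟩ := Λ.factorisation a 0 0 (by simpa using h)
  have h1 := hu (a, Λ.one (Λ.src a)) ⟨h, Λ.deg_one _, _, Λ.comp_one a⟩
  have h2 := hu (Λ.one (Λ.rng a), a) ⟨Λ.deg_one _, h, _, Λ.one_comp a⟩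
  exact congrArg Prod.fst (h1.trans h2.symm)

end

/-! ### Infinite paths -/

/-- An infinite path: a degree-preserving functor from `Ω_k` to `Λ`, where `Ω_k` has objects
`ℕ^k` and one morphism `(p, q)`, of range `p`, source `q` and degree `q - p`, for each `p ≤ q`. -/
@[ext]
structure InfPath where
  vert : (Fin k → ℕ) → V
  seg : (p q : Fin k → ℕ) → p ≤ q → P
  rng_seg : ∀ p q h, Λ.rng (seg p q h) = vert p
  src_seg : ∀ p q h, Λ.src (seg p q h) = vert q
  seg_self : ∀ p, seg p p le_rfl = Λ.one (vert p)
  seg_comp : ∀ p q n (h₁ : p ≤ q) (h₂ : q ≤ n),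
    Λ.comp (seg p q h₁) (seg q n h₂) ((src_seg p q h₁).trans (rng_seg q n h₂).symm)
      = seg p n (h₁.trans h₂)
  deg_seg : ∀ p q h, Λ.deg (seg p q h) = q - p

variable {Λ}

/-- The range `x(0)` of an infinite path. -/
def InfPath.rng (x : Λ.InfPath) : V := x.vert 0

/-- The shift `σ^n`, with `σ^n(x)(p, q) = x(p + n, q + n)`. -/
def InfPath.shift (n : Fin k → ℕ) (x : Λ.InfPath) : Λ.InfPath where
  vert p := x.vert (p + n)
  seg p q h := x.seg (p + n) (q + n) (add_le_add_left h n)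
  rng_seg p q h := x.rng_seg _ _ _
  src_seg p q h := x.src_seg _ _ _
  seg_self p := x.seg_self _
  seg_comp p q m h₁ h₂ := x.seg_comp _ _ _ _ _
  deg_seg p q h := by rw [x.deg_seg]; exact add_tsub_add_eq_tsub_right q n p

/-- `z = a y`: the infinite path `a y` is the one with `(a y)(0, d(a)) = a` and
`σ^{d(a)}(a y) = y` (it exists exactly when `s(a) = r(y)`, and is then unique). -/
def IsConcat (a : P) (y z : Λ.InfPath) : Prop :=
  z.seg 0 (Λ.deg a) zero_le = a ∧ z.shift (Λ.deg a) = y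

variable (Λ)

/-- The cylinder set `Z(a)`. -/
def cylinder (a : P) : Set Λ.InfPath := {x | ∃ y, IsConcat a y x}

/-- The topology of `Λ^∞`, with the cylinder sets as a basis. -/
instance : TopologicalSpace Λ.InfPath :=
  TopologicalSpace.generateFrom (Set.range Λ.cylinder)

/-- The Borel σ-algebra of `Λ^∞`. -/
instance : MeasurableSpace Λ.InfPath := borel _

instance : BorelSpace Λ.InfPath := ⟨rfl⟩

/-! ### Perron-Frobenius data -/

/-- The coordinate adjacency matrix `B_i(v, w) = |v Λ^{e_i} w|`. -/
noncomputable def adj (i : Fin k) : Matrix V V ℝ :=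
  fun x y => ({a | Λ.rng a = x ∧ Λ.src a = y ∧ Λ.deg a = Pi.single i 1}.ncard : ℝ)

section PerronFrobenius

variable [Fintype V] [DecidableEq V]

/-- The spectral radius `ρ(B_i)`: the largest modulus of a complex eigenvalue of `B_i`. -/
noncomputable def rho (i : Fin k) : ℝ :=
  (spectralRadius ℂ ((Λ.adj i).map (fun t : ℝ => (t : ℂ)))).toReal

/-- `ρ(Λ)^p = ∏ i, ρ(B_i)^{p_i}`. -/
noncomputable def rhoPow (p : Fin k → ℕ) : ℝ := ∏ i, Λ.rho i ^ p i

/-- `x` is a strictly positive vector of unit 1-norm with `B_i x = ρ(B_i) x` for all `i`. -/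
def IsPFVector (x : V → ℝ) : Prop :=
  (∀ y, 0 < x y) ∧ ∑ y, |x y| = 1 ∧ ∀ i, (Λ.adj i).mulVec x = Λ.rho i • x

open Classical in
/-- The unimodular Perron-Frobenius eigenvector `x_Λ`: the unique vector with `IsPFVector`. -/
noncomputable def pfVector : V → ℝ :=
  if h : ∃ x, Λ.IsPFVector x then h.choose else 0

/-- `M` is a Borel probability measure with `M(Z(a)) = ρ(Λ)^{-d(a)} x_Λ(s(a))` for all `a`. -/
def IsPFMeasure (M : Measure Λ.InfPath) : Prop :=
  IsProbabilityMeasure M ∧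
    ∀ a, M.real (Λ.cylinder a) = (Λ.rhoPow (Λ.deg a))⁻¹ * Λ.pfVector (Λ.src a)

open Classical in
/-- The Perron-Frobenius measure on `Λ^∞`: the unique measure with `IsPFMeasure`. -/
noncomputable def pfMeasure : Measure Λ.InfPath :=
  if h : ∃ M, Λ.IsPFMeasure M then h.choose else 0

end PerronFrobenius

/-! ### Partial isomorphisms and self-similar groupoid actions -/

/-- A partial isomorphism of `Λ` from `x Λ` to `y Λ`. -/
structure PIso (x y : V) where
  toEquiv : {a // Λ.rng a = x} ≃ {a // Λ.rng a = y}
  deg_map : ∀ a, Λ.deg (toEquiv a).1 = Λ.deg a.1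
  map_comp_edge : ∀ (a : {a // Λ.rng a = x}) (e : P) (h : Λ.src a.1 = Λ.rng e), Λ.IsEdge e →
    ∃ b h', (toEquiv ⟨Λ.comp a.1 e h, (Λ.rng_comp _ _ _).trans a.2⟩).1
      = Λ.comp (toEquiv a).1 b h'

end KGraph

/-- The elements of a groupoid with unit space `V`. -/
@[ext]
structure GElt (V : Type u) [Groupoid.{w} V] where
  dom : V
  cod : V
  hom : dom ⟶ cod

/-- The unit of the groupoid at `x`. -/
def GElt.unit {V : Type u} [Groupoid.{w} V] (x : V) : GElt V := ⟨x, x, 𝟙 x⟩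

/-- A faithful action of a groupoid with unit space `V` on the `k`-graph `Λ` by partial
isomorphisms. (In the categorical notation `g ≫ h` is the groupoid product `h g`.) -/
structure FaithfulAction {k : ℕ} {V : Type u} {P : Type v} [Groupoid.{w} V]
    (Λ : KGraph k V P) where
  act : {x y : V} → (x ⟶ y) → Λ.PIso x y
  act_id : ∀ x a, (act (𝟙 x)).toEquiv a = a
  act_comp : ∀ {x y z : V} (g : x ⟶ y) (h : y ⟶ z) a,
    (act (g ≫ h)).toEquiv a = (act h).toEquiv ((act g).toEquiv a)
  faithful : ∀ {x y : V} (g h : x ⟶ y),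
    (∀ a, (act g).toEquiv a = (act h).toEquiv a) → g = h

namespace FaithfulAction

variable {k : ℕ} {V : Type u} {P : Type v} [Groupoid.{w} V] {Λ : KGraph k V P}
  (S : FaithfulAction Λ)

/-- `g · a`, for `a ∈ dom(g) Λ`. -/
def smul (g : GElt V) (a : P) (h : Λ.rng a = g.dom) : P := ((S.act g.hom).toEquiv ⟨a, h⟩).1

theorem rng_smul (g : GElt V) (a : P) (h : Λ.rng a = g.dom) : Λ.rng (S.smul g a h) = g.cod :=
  ((S.act g.hom).toEquiv ⟨a, h⟩).2

theorem deg_smul (g : GElt V) (a : P) (h : Λ.rng a = g.dom) :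
    Λ.deg (S.smul g a h) = Λ.deg a :=
  (S.act g.hom).deg_map ⟨a, h⟩

/-- `h` satisfies `g · (a b) = (g · a) (h · b)` for all `b ∈ s(a) Λ`. -/
def IsRestriction (g : GElt V) (a : P) (ha : Λ.rng a = g.dom) (h : GElt V) : Prop :=
  ∃ (hd : h.dom = Λ.src a) (hc : h.cod = Λ.src (S.smul g a ha)),
    ∀ (b : P) (hb : Λ.src a = Λ.rng b),
      S.smul g (Λ.comp a b hb) ((Λ.rng_comp a b hb).trans ha)
        = Λ.comp (S.smul g a ha) (S.smul h b (hb.symm.trans hd.symm))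
            (hc.symm.trans (S.rng_smul h b _).symm)

end FaithfulAction

/-- A self-similar groupoid action: a faithful action such that for every `g` and every edge
`e ∈ dom(g) Λ` there is `h` with `g · (e b) = (g · e) (h · b)` for all `b ∈ s(e) Λ`. -/
structure SelfSimilarAction {k : ℕ} {V : Type u} {P : Type v} [Groupoid.{w} V]
    (Λ : KGraph k V P) extends FaithfulAction Λ where
  self_similar : ∀ (g : GElt V) (e : P) (he : Λ.rng e = g.dom), Λ.IsEdge e →
    ∃ h, toFaithfulAction.IsRestriction g e he h

namespace SelfSimilarAction

variable {k : ℕ} {V : Type u} {P : Type v} [Groupoid.{w} V] {Λ : KGraph k V P}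
  (S : SelfSimilarAction Λ)

theorem ext_of_smul {g h : GElt V} (hd : g.dom = h.dom) (hc : g.cod = h.cod)
    (H : ∀ a (ha : Λ.rng a = g.dom), S.smul g a ha = S.smul h a (ha.trans hd)) : g = h := by
  obtain ⟨x, y, g⟩ := g
  obtain ⟨x', y', h⟩ := h
  dsimp only at hd hc
  subst hd hc
  have : g = h := S.faithful g h fun a => Subtype.ext (H a.1 a.2)
  rw [this]

theorem restriction_unique {g : GElt V} {a : P} {ha : Λ.rng a = g.dom} {h h' : GElt V}
    (H : S.IsRestriction g a ha h) (H' : S.IsRestriction g a ha h') : h = h' := by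
  obtain ⟨hd, hc, e⟩ := H
  obtain ⟨hd', hc', e'⟩ := H'
  refine S.ext_of_smul (hd.trans hd'.symm) (hc.trans hc'.symm) fun b hb => ?_
  have hb' : Λ.src a = Λ.rng b := (hb.trans hd).symm
  exact KGraph.comp_left_cancel _ _ ((e b hb').symm.trans (e' b hb'))

theorem smul_congr {g : GElt V} {a b : P} (e : a = b) (ha : Λ.rng a = g.dom) :
    S.smul g a ha = S.smul g b (e ▸ ha) := by
  subst e; rfl

theorem isRestriction_comp {g h h' : GElt V} {a b : P} {ha : Λ.rng a = g.dom}
    (hab : Λ.src a = Λ.rng b) {hb : Λ.rng b = h.dom}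
    (H : S.IsRestriction g a ha h) (H' : S.IsRestriction h b hb h') :
    S.IsRestriction g (Λ.comp a b hab) ((Λ.rng_comp _ _ _).trans ha) h' := by
  obtain ⟨hd, hc, e⟩ := H
  obtain ⟨hd', hc', e'⟩ := H'
  refine ⟨hd'.trans (Λ.src_comp _ _ _).symm, ?_, fun c hc₂ => ?_⟩
  · rw [e b hab, Λ.src_comp]; exact hc'
  · have hbc : Λ.src b = Λ.rng c := (Λ.src_comp a b hab).symm.trans hc₂
    rw [S.smul_congr (Λ.assoc a b c hab hbc), e]
    simp only [e' c hbc, e b hab]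
    rw [Λ.assoc]

theorem exists_restriction_aux (n : ℕ) : ∀ (g : GElt V) (a : P) (ha : Λ.rng a = g.dom),
    ∑ i, Λ.deg a i = n → ∃ h, S.IsRestriction g a ha h := by
  induction n with
  | zero =>
    intro g a ha hn
    have h0 : Λ.deg a = 0 := by
      funext i
      exact (Finset.sum_eq_zero_iff.1 hn) i (Finset.mem_univ i)
    have ha1 := KGraph.eq_one_of_deg_eq_zero h0
    have hs : Λ.src a = Λ.rng a := by
      rw [ha1, Λ.src_one, Λ.rng_one]
    have hg0 : Λ.deg (S.smul g a ha) = 0 := (S.deg_smul g a ha).trans h0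
    have hg1 := KGraph.eq_one_of_deg_eq_zero hg0
    have hgs : Λ.src (S.smul g a ha) = g.cod := by
      rw [hg1, Λ.src_one, S.rng_smul]
    refine ⟨g, ha.symm.trans hs.symm, hgs.symm, fun b hb => ?_⟩
    have e1 : Λ.comp a b hb = b := by
      have : ∀ (c : P) (h : c = Λ.one (Λ.rng b)) (h' : Λ.src c = Λ.rng b),
          Λ.comp c b h' = b := by
        intro c h h'; subst h; exact Λ.one_comp b
      exact this a (by rw [← hb, hs]; exact ha1) hb
    have e2 : ∀ (c d : P) (h : c = Λ.one (Λ.rng d)) (h' : Λ.src c = Λ.rng d),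
          Λ.comp c d h' = d := by
        intro c d h h'; subst h; exact Λ.one_comp d
    rw [S.smul_congr e1]
    refine (e2 _ _ ?_ _).symm
    rw [S.rng_smul]
    rw [S.rng_smul] at hg1
    exact hg1
  | succ n ih =>
    intro g a ha hn
    obtain ⟨i, hi⟩ : ∃ i, Λ.deg a i ≠ 0 := by
      by_contra hcon
      push Not at hcon
      simp [hcon] at hn
    have hle : Pi.single i 1 ≤ Λ.deg a := by
      intro j
      by_cases hj : j = i
      · subst hj; simpa using Nat.one_le_iff_ne_zero.2 hi
      · simp [Pi.single_eq_of_ne hj]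
    obtain ⟨⟨e, b⟩, ⟨he, hb, hc, hcomp⟩, _⟩ :=
      Λ.factorisation a (Pi.single i 1) (Λ.deg a - Pi.single i 1)
        (add_tsub_cancel_of_le hle).symm
    dsimp only at he hb hc hcomp
    subst hcomp
    have her : Λ.rng e = g.dom := (Λ.rng_comp _ _ _).symm.trans ha
    obtain ⟨h, hh⟩ := S.self_similar g e her ⟨i, he⟩
    have hsum : ∑ j, Λ.deg b j = n := by
      have h1 : ∑ j, Λ.deg (Λ.comp e b hc) j = ∑ j, Λ.deg e j + ∑ j, Λ.deg b j := by
        rw [Λ.deg_comp, ← Finset.sum_add_distrib]; rfl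
      have h2 : ∑ j, Λ.deg e j = 1 := by rw [he]; simp
      omega
    obtain ⟨h', hh'⟩ := ih h b (hc.symm.trans hh.1.symm) hsum
    exact ⟨h', S.isRestriction_comp hc hh hh'⟩

theorem exists_restriction (g : GElt V) (a : P) (ha : Λ.rng a = g.dom) :
    ∃ h, S.IsRestriction g a ha h :=
  S.exists_restriction_aux _ g a ha rfl

/-- The restriction `g|_a`: the unique `h` with `g · (a b) = (g · a) (h · b)` for all
`b ∈ s(a) Λ`. -/
noncomputable def restr (g : GElt V) (a : P) (ha : Λ.rng a = g.dom) : GElt V :=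
  (S.exists_restriction g a ha).choose

theorem restr_spec (g : GElt V) (a : P) (ha : Λ.rng a = g.dom) :
    S.IsRestriction g a ha (S.restr g a ha) :=
  (S.exists_restriction g a ha).choose_spec

theorem dom_restr (g : GElt V) (a : P) (ha : Λ.rng a = g.dom) :
    (S.restr g a ha).dom = Λ.src a :=
  (S.restr_spec g a ha).1

theorem cod_restr (g : GElt V) (a : P) (ha : Λ.rng a = g.dom) :
    (S.restr g a ha).cod = Λ.src (S.smul g a ha) :=
  (S.restr_spec g a ha).2.1

theorem smul_comp (g : GElt V) (a b : P) (ha : Λ.rng a = g.dom) (hb : Λ.src a = Λ.rng b) :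
    S.smul g (Λ.comp a b hb) ((Λ.rng_comp a b hb).trans ha)
      = Λ.comp (S.smul g a ha) (S.smul (S.restr g a ha) b (hb.symm.trans (S.dom_restr g a ha).symm))
          ((S.cod_restr g a ha).symm.trans (S.rng_smul _ _ _).symm) :=
  (S.restr_spec g a ha).2.2 b hb

theorem restr_comp (g : GElt V) (a b : P) (ha : Λ.rng a = g.dom) (hb : Λ.src a = Λ.rng b) :
    S.restr g (Λ.comp a b hb) ((Λ.rng_comp a b hb).trans ha)
      = S.restr (S.restr g a ha) b (hb.symm.trans (S.dom_restr g a ha).symm) :=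
  S.restriction_unique (S.restr_spec _ _ _)
    (S.isRestriction_comp hb (S.restr_spec g a ha) (S.restr_spec _ _ _))

theorem restr_congr {g : GElt V} {a b : P} (e : a = b) (ha : Λ.rng a = g.dom) :
    S.restr g a ha = S.restr g b (e ▸ ha) := by
  subst e; rfl

theorem restr_seg (g : GElt V) (x : Λ.InfPath) (hx : x.rng = g.dom) (p q : Fin k → ℕ)
    (h : p ≤ q) :
    S.restr (S.restr g (x.seg 0 p zero_le) ((x.rng_seg _ _ _).trans hx)) (x.seg p q h)
        ((x.rng_seg _ _ _).trans ((x.src_seg _ _ _).symm.trans (S.dom_restr _ _ _).symm))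
      = S.restr g (x.seg 0 q zero_le) ((x.rng_seg _ _ _).trans hx) := by
  exact (S.restr_comp g _ _ ((x.rng_seg _ _ _).trans hx)
    ((x.src_seg 0 p zero_le).trans (x.rng_seg p q h).symm)).symm.trans
    (S.restr_congr (x.seg_comp 0 p q zero_le h) _)

/-- The action on infinite paths, `(g · x)(p, q) = g|_{x(0, p)} · x(p, q)`. -/
noncomputable def actInf (g : GElt V) (x : Λ.InfPath) (hx : x.rng = g.dom) : Λ.InfPath where
  vert p := (S.restr g (x.seg 0 p zero_le) ((x.rng_seg _ _ _).trans hx)).cod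
  seg p q h := S.smul (S.restr g (x.seg 0 p zero_le) ((x.rng_seg _ _ _).trans hx)) (x.seg p q h)
    ((x.rng_seg _ _ _).trans ((x.src_seg _ _ _).symm.trans (S.dom_restr _ _ _).symm))
  rng_seg p q h := S.rng_smul _ _ _
  src_seg p q h := by
    rw [← S.cod_restr, S.restr_seg g x hx p q h]
  seg_self p := by
    have h0 := KGraph.eq_one_of_deg_eq_zero (a := S.smul (S.restr g (x.seg 0 p zero_le)
      ((x.rng_seg _ _ _).trans hx)) (x.seg p p le_rfl)
      ((x.rng_seg _ _ _).trans ((x.src_seg _ _ _).symm.trans (S.dom_restr _ _ _).symm)))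
      (by rw [S.deg_smul, x.deg_seg, tsub_self])
    rw [S.rng_smul] at h0
    exact h0
  seg_comp p q n h₁ h₂ := by
    simp only [← S.restr_seg g x hx p q h₁]
    rw [← S.smul_comp _ _ _ _ ((x.src_seg p q h₁).trans (x.rng_seg q n h₂).symm)]
    exact S.smul_congr (x.seg_comp p q n h₁ h₂) _
  deg_seg p q h := by rw [S.deg_smul, x.deg_seg]

/-- The action is finite-state: `{g|_a : a ∈ dom(g) Λ}` is finite for every non-unit `g`. -/
def IsFiniteState : Prop :=
  ∀ g : GElt V, (∀ x, g ≠ GElt.unit x) → {h | ∃ a ha, S.restr g a ha = h}.Finite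

/-! ### Periodicity -/

/-- The `G`-periodicity group: the set of `p - q` such that there is `g ∈ G` with
`σ^p(x) = σ^q(g · x)` for all `x ∈ dom(g) Λ^∞`. -/
def per : Set (Fin k → ℤ) :=
  {n | ∃ p q : Fin k → ℕ, (n = fun i => (p i : ℤ) - (q i : ℤ)) ∧
    ∃ g : GElt V, ∀ (x : Λ.InfPath) (hx : x.rng = g.dom), x.shift p = (S.actInf g x hx).shift q}

/-- `(b, h)` is a pair in `Λ^q × G` with `a (h · x) = b x` for all `x ∈ dom(h) Λ^∞`. -/
def IsPeriodPair (q : Fin k → ℕ) (a : P) (bh : P × GElt V) : Prop :=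
  Λ.deg bh.1 = q ∧ ∀ (x : Λ.InfPath) (hx : x.rng = bh.2.dom),
    ∃ z, KGraph.IsConcat a (S.actInf bh.2 x hx) z ∧ KGraph.IsConcat bh.1 x z

open Classical in
/-- For `d(a) - q` in the periodicity group, the unique pair `(θ_{p,q}(a), h_{p,q}(a))`, where
`p = d(a)`, that satisfies `IsPeriodPair`. -/
noncomputable def periodPair (q : Fin k → ℕ) (a : P) : P × GElt V :=
  if h : ∃ bh, S.IsPeriodPair q a bh then h.choose else (a, GElt.unit (Λ.src a))

/-- `θ_{p,q}(a)`, where `p = d(a)`. -/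
noncomputable def theta (q : Fin k → ℕ) (a : P) : P := (S.periodPair q a).1

/-- `h_{p,q}(a)`, where `p = d(a)`. -/
noncomputable def hElt (q : Fin k → ℕ) (a : P) : GElt V := (S.periodPair q a).2

/-- The set `F^l_{p,q,a}(g, x)`, where `p = d(a)`: the `m ∈ dom(g) Λ^{lN} x`, `N = (1, …, 1)`, with
`g · m = h · m` and `g|_m = h|_m`, where `h = h_{p,q}(a)`. -/
def fixSet (q : Fin k → ℕ) (a : P) (l : ℕ) (g : GElt V) (x : V) : Set P :=
  {m | Λ.deg m = (fun _ => l) ∧ Λ.src m = x ∧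
    ∃ (hg : Λ.rng m = g.dom) (hh : Λ.rng m = (S.hElt q a).dom),
      S.smul g m hg = S.smul (S.hElt q a) m hh ∧ S.restr g m hg = S.restr (S.hElt q a) m hh}

section PerronFrobenius

variable [Fintype V] [DecidableEq V]

/-- `c^l_{p,q,a}(g) = ρ(Λ)^{-lN} ∑ x, |F^l_{p,q,a}(g, x)| x_Λ(x)`, where `p = d(a)`. -/
noncomputable def cSeq (q : Fin k → ℕ) (a : P) (g : GElt V) (l : ℕ) : ℝ :=
  (Λ.rhoPow fun _ => l)⁻¹ * ∑ x, ((S.fixSet q a l g x).ncard : ℝ) * Λ.pfVector x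

/-- `c_{p,q,a}(g) = lim_l c^l_{p,q,a}(g)`, where `p = d(a)`. -/
noncomputable def cLim (q : Fin k → ℕ) (a : P) (g : GElt V) : ℝ :=
  limUnder atTop (S.cSeq q a g)

end PerronFrobenius

/-- The set `Z(a, g, b)` of those `x ∈ Λ^∞` such that `x = a (g · y) = b y` for some `y`, where
`s(a) = g · s(b)`. -/
def zSet (a : P) (g : GElt V) (b : P) : Set Λ.InfPath :=
  {x | ∃ (y : Λ.InfPath) (hy : y.rng = g.dom),
    KGraph.IsConcat a (S.actInf g y hy) x ∧ KGraph.IsConcat b y x}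

end SelfSimilarAction

/-! Let `E = agreeSet a g b` be the set of those `y` with `a (g · y) = b y`. Then `Z(a, g, b)` is `b
E`. Prefixing `b` scales the measure of a closed set by `ρ(Λ)^{-d(b)}`
(`IsPFMeasure.real_setOf_shift_mem`), so only `M(E)` has to be found.

Suppose that `d(a) - d(b)` is a period, with pair `(θ, h)`. Every infinite path that starts with `a`
starts with `θ` (`IsPeriodPair.init_eq`), so `E` is empty unless `b = θ`. If `b = θ`, then `a (h ·
y) = b y` for all `y`, and cancelling `a` shows that `E` is the set on which `g` and `h` agree
(`agreeSet_eq_eqSet`). For `g = h` this is all of `s(b) Λ^∞`. Otherwise the paths with an initial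
segment of degree `lN` on which `g` and `h` have equal values and equal restrictions form an
increasing sequence of subsets of `E`. Their measures are the `c^l`, and their union is almost all
of `E` (`real_eqSet_diff`), so the limit exists and equals `M(E)`. If `d(a) - d(b)` is not a period,
then `E` is null (`real_agreeSet_of_notMem_per`).

Both null sets come from one zero-one argument, `IsPFMeasure.real_eq_zero`. Suppose that below each
initial segment of a point of a closed set `E` the tails of `E` lie in a proper closed set from a
finite family. Since `M` charges every cylinder, each such tail set misses a definite proportion of
the mass, so some `c < 1` satisfies `M(E) ≤ c M(E_n)` for every cylinder approximation `E_n` of `E`.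
As `E_n` decreases to `E`, `M(E) ≤ c M(E)`. The finite-state condition supplies the finite family.
Properness holds because a full tail set would be a period in one case, and equality of the
restrictions of `g` and `h` in the other.

The Perron-Frobenius vector and measure are chosen objects, so their existence is proved too: the
vector by Perron's theorem, the measure as the law of a random path. -/

/-! ### Composites and initial segments -/

namespace KGraph

section Factorisation

variable {k : ℕ} {V : Type u} {P : Type v} {Λ : KGraph k V P}

/-- `c = a b` in `Λ`. -/
def IsComp (Λ : KGraph k V P) (a b c : P) : Prop := ∃ h, Λ.comp a b h = c

theorem isComp_comp (a b : P) (h : Λ.src a = Λ.rng b) : Λ.IsComp a b (Λ.comp a b h) := ⟨h, rfl⟩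

theorem isComp_one_left (a : P) : Λ.IsComp (Λ.one (Λ.rng a)) a a := ⟨_, Λ.one_comp a⟩

theorem isComp_one_right (a : P) : Λ.IsComp a (Λ.one (Λ.src a)) a := ⟨_, Λ.comp_one a⟩

namespace IsComp

variable {a b c d e f a' b' c' : P}

theorem src_left (H : Λ.IsComp a b c) : Λ.src a = Λ.rng b := H.1

theorem rng_eq (H : Λ.IsComp a b c) : Λ.rng c = Λ.rng a := by
  obtain ⟨h, rfl⟩ := H; exact Λ.rng_comp _ _ _

theorem src_eq (H : Λ.IsComp a b c) : Λ.src c = Λ.src b := by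
  obtain ⟨h, rfl⟩ := H; exact Λ.src_comp _ _ _

theorem deg_eq (H : Λ.IsComp a b c) : Λ.deg c = Λ.deg a + Λ.deg b := by
  obtain ⟨h, rfl⟩ := H; exact Λ.deg_comp _ _ _

theorem unique (H : Λ.IsComp a b c) (H' : Λ.IsComp a b c') : c = c' := by
  obtain ⟨h, rfl⟩ := H; obtain ⟨h', rfl⟩ := H'; rfl

theorem inj (H : Λ.IsComp a b c) (H' : Λ.IsComp a' b' c) (hd : Λ.deg a = Λ.deg a') :
    a = a' ∧ b = b' := by
  have hd' : Λ.deg b = Λ.deg b' := by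
    have h1 := H.deg_eq.symm.trans H'.deg_eq
    rw [hd] at h1
    exact add_left_cancel h1
  obtain ⟨_, _, hu⟩ := Λ.factorisation c _ _ H.deg_eq
  have h1 := hu (a, b) ⟨rfl, rfl, H⟩
  have h2 := hu (a', b') ⟨hd.symm, hd'.symm, H'⟩
  exact Prod.ext_iff.1 (h1.trans h2.symm)

theorem left_cancel (H : Λ.IsComp a b c) (H' : Λ.IsComp a b' c) : b = b' := (H.inj H' rfl).2

theorem assoc_left (H : Λ.IsComp a b d) (H' : Λ.IsComp d c e) :
    ∃ f, Λ.IsComp b c f ∧ Λ.IsComp a f e := by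
  obtain ⟨h, rfl⟩ := H
  obtain ⟨h', rfl⟩ := H'
  have h₂ : Λ.src b = Λ.rng c := (Λ.src_comp a b h).symm.trans h'
  exact ⟨_, isComp_comp b c h₂, _, (Λ.assoc a b c h h₂).symm⟩

theorem assoc_right (H : Λ.IsComp b c f) (H' : Λ.IsComp a f e) :
    ∃ d, Λ.IsComp a b d ∧ Λ.IsComp d c e := by
  obtain ⟨h, rfl⟩ := H
  obtain ⟨h', rfl⟩ := H'
  have h₁ : Λ.src a = Λ.rng b := h'.trans (Λ.rng_comp b c h)
  exact ⟨_, isComp_comp a b h₁, _, Λ.assoc a b c h₁ h⟩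

theorem assoc_iff (H : Λ.IsComp a b d) (H' : Λ.IsComp b c f) :
    Λ.IsComp d c e ↔ Λ.IsComp a f e := by
  constructor
  · intro h
    obtain ⟨f', h1, h2⟩ := H.assoc_left h
    rwa [H'.unique h1]
  · intro h
    obtain ⟨d', h1, h2⟩ := H'.assoc_right h
    rwa [H.unique h1]

end IsComp

theorem exists_isComp {c : P} {m n : Fin k → ℕ} (h : Λ.deg c = m + n) :
    ∃ a b, Λ.deg a = m ∧ Λ.deg b = n ∧ Λ.IsComp a b c := by
  obtain ⟨⟨a, b⟩, ⟨ha, hb, hc⟩, _⟩ := Λ.factorisation c m n h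
  exact ⟨a, b, ha, hb, hc⟩

theorem exists_isComp_of_le {c : P} {m : Fin k → ℕ} (h : m ≤ Λ.deg c) :
    ∃ a, Λ.deg a = m ∧ ∃ b, Λ.IsComp a b c := by
  obtain ⟨a, b, ha, -, hc⟩ := exists_isComp (add_tsub_cancel_of_le h).symm
  exact ⟨a, ha, b, hc⟩

open Classical in
/-- The initial segment of `c` of degree `m`, for `m ≤ d(c)`. -/
noncomputable def pre (Λ : KGraph k V P) (c : P) (m : Fin k → ℕ) : P :=
  if h : m ≤ Λ.deg c then (exists_isComp_of_le h).choose else c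

theorem pre_spec {c : P} {m : Fin k → ℕ} (h : m ≤ Λ.deg c) :
    Λ.deg (Λ.pre c m) = m ∧ ∃ b, Λ.IsComp (Λ.pre c m) b c := by
  rw [pre, dif_pos h]
  exact (exists_isComp_of_le h).choose_spec

theorem deg_pre {c : P} {m : Fin k → ℕ} (h : m ≤ Λ.deg c) : Λ.deg (Λ.pre c m) = m :=
  (pre_spec h).1

theorem IsComp.pre_eq {a b c : P} (H : Λ.IsComp a b c) {m : Fin k → ℕ} (hm : Λ.deg a = m) :
    Λ.pre c m = a := by
  have hle : m ≤ Λ.deg c := by rw [H.deg_eq, hm]; exact le_self_add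
  obtain ⟨h1, b', h2⟩ := pre_spec hle
  exact (h2.inj H (h1.trans hm.symm)).1

theorem IsComp.pre_pre {a b c : P} (H : Λ.IsComp a b c) {m : Fin k → ℕ} (hm : m ≤ Λ.deg a) :
    Λ.pre c m = Λ.pre a m := by
  obtain ⟨h1, b', h2⟩ := pre_spec hm
  obtain ⟨f, -, h3⟩ := h2.assoc_left H
  exact h3.pre_eq h1

theorem pre_self (c : P) : Λ.pre c (Λ.deg c) = c := (isComp_one_right c).pre_eq rfl

theorem rng_pre {c : P} {m : Fin k → ℕ} (h : m ≤ Λ.deg c) : Λ.rng (Λ.pre c m) = Λ.rng c := by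
  obtain ⟨h1, b', h2⟩ := pre_spec h
  exact h2.rng_eq.symm

theorem exists_isComp_pre {c : P} {m n : Fin k → ℕ} (hmn : m ≤ n) (hn : n ≤ Λ.deg c) :
    ∃ b, Λ.IsComp (Λ.pre c m) b (Λ.pre c n) := by
  obtain ⟨h1, b', h2⟩ := pre_spec hn
  have hm : m ≤ Λ.deg (Λ.pre c n) := by rwa [h1]
  rw [h2.pre_pre hm]
  exact (pre_spec hm).2

theorem one_of_deg {a : P} (h : Λ.deg a = 0) : a = Λ.one (Λ.rng a) ∧ Λ.src a = Λ.rng a := by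
  have h1 := eq_one_of_deg_eq_zero h
  refine ⟨h1, ?_⟩
  rw [h1, Λ.src_one, Λ.rng_one]

end Factorisation

/-! ### Infinite paths in terms of their initial segments -/

namespace InfPath

variable {k : ℕ} {V : Type u} {P : Type v} {Λ : KGraph k V P}

/-- The initial segment `x(0, p)`. -/
def init (x : Λ.InfPath) (p : Fin k → ℕ) : P := x.seg 0 p zero_le

theorem deg_init (x : Λ.InfPath) (p : Fin k → ℕ) : Λ.deg (x.init p) = p := by
  rw [init, x.deg_seg, tsub_zero]

theorem rng_init (x : Λ.InfPath) (p : Fin k → ℕ) : Λ.rng (x.init p) = x.rng := x.rng_seg _ _ _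

theorem src_init (x : Λ.InfPath) (p : Fin k → ℕ) : Λ.src (x.init p) = x.vert p := x.src_seg _ _ _

theorem isComp_init_seg (x : Λ.InfPath) {p q : Fin k → ℕ} (h : p ≤ q) :
    Λ.IsComp (x.init p) (x.seg p q h) (x.init q) := ⟨_, x.seg_comp 0 p q zero_le h⟩

theorem pre_init (x : Λ.InfPath) {p q : Fin k → ℕ} (h : p ≤ q) :
    Λ.pre (x.init q) p = x.init p := (x.isComp_init_seg h).pre_eq (x.deg_init p)

/-- `x(p, q)` is the only path that completes `x(0, p)` to `x(0, q)`, so the initial segments carry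
all the data. -/
theorem ext_init {x y : Λ.InfPath} (h : ∀ p, x.init p = y.init p) : x = y := by
  have hv : x.vert = y.vert := by
    funext p; rw [← src_init, ← src_init, h]
  have hs : x.seg = y.seg := by
    funext p q hpq
    have h1 := x.isComp_init_seg hpq
    rw [h p, h q] at h1
    exact h1.left_cancel (y.isComp_init_seg hpq)
  exact InfPath.ext hv hs

theorem isComp_init_shift (x : Λ.InfPath) (n p : Fin k → ℕ) :
    Λ.IsComp (x.init n) ((x.shift n).init p) (x.init (n + p)) := by
  -- The shifted segment runs from `0 + n` to `p + n`. Free endpoints allow both to be rewritten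
  -- together with the inequality between them.
  have key : ∀ (m q : Fin k → ℕ) (hm : m ≤ q), m = n → q = n + p →
      Λ.IsComp (x.init n) (x.seg m q hm) (x.init (n + p)) := by
    rintro m q hm rfl rfl
    exact x.isComp_init_seg hm
  exact key (0 + n) (p + n) _ (zero_add n) (add_comm p n)

theorem eq_shift_iff {x y : Λ.InfPath} {n : Fin k → ℕ} :
    x.shift n = y ↔ ∀ p, Λ.IsComp (x.init n) (y.init p) (x.init (n + p)) := by
  constructor
  · rintro rfl p
    exact x.isComp_init_shift n p
  · intro h
    exact ext_init fun p => (x.isComp_init_shift n p).left_cancel (h p)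

theorem rng_shift (x : Λ.InfPath) (n : Fin k → ℕ) : (x.shift n).rng = Λ.src (x.init n) := by
  rw [(x.isComp_init_shift n 0).src_left, rng_init]

theorem shift_shift (x : Λ.InfPath) (m n : Fin k → ℕ) :
    (x.shift m).shift n = x.shift (m + n) := by
  rw [eq_shift_iff]
  intro p
  have h1 := x.isComp_init_shift m n
  have h2 := x.isComp_init_shift (m + n) p
  obtain ⟨f, h3, h4⟩ := h1.assoc_left h2
  have h5 := x.isComp_init_shift m (n + p)
  rw [← add_assoc] at h5
  rwa [h5.left_cancel h4]

/-- The infinite path with prescribed initial segments. -/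
noncomputable def ofInit (f : (Fin k → ℕ) → P) (hd : ∀ p, Λ.deg (f p) = p)
    (hf : ∀ p q, p ≤ q → ∃ b, Λ.IsComp (f p) b (f q)) : Λ.InfPath where
  vert p := Λ.src (f p)
  seg p q h := (hf p q h).choose
  rng_seg p q h := (hf p q h).choose_spec.src_left.symm
  src_seg p q h := (hf p q h).choose_spec.src_eq.symm
  seg_self p := ((hf p p le_rfl).choose_spec).left_cancel (isComp_one_right (f p))
  seg_comp p q n h₁ h₂ := by
    obtain ⟨c, h3, h4⟩ := (hf p q h₁).choose_spec.assoc_left (hf q n h₂).choose_spec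
    rw [(hf p n (h₁.trans h₂)).choose_spec.left_cancel h4]
    exact h3.2
  deg_seg p q h := by
    have h1 := (hf p q h).choose_spec.deg_eq
    rw [hd, hd] at h1
    exact (tsub_eq_of_eq_add_rev h1).symm

theorem init_ofInit (f : (Fin k → ℕ) → P) (hd : ∀ p, Λ.deg (f p) = p)
    (hf : ∀ p q, p ≤ q → ∃ b, Λ.IsComp (f p) b (f q)) (p : Fin k → ℕ) :
    (ofInit f hd hf).init p = f p := by
  have h0 := one_of_deg (hd 0)
  have h1 := (hf 0 p zero_le).choose_spec
  have h2 : Λ.rng (f p) = Λ.src (f 0) := h1.rng_eq.trans h0.2.symm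
  have h3 : Λ.IsComp (f 0) (f p) (f p) := by
    have := isComp_one_left (Λ := Λ) (f p)
    rwa [h1.rng_eq, ← h0.1] at this
  exact h1.left_cancel h3

/-- The constant degree `(n, …, n)`. -/
def _root_.KGraph.diag (k n : ℕ) : Fin k → ℕ := fun _ => n

theorem _root_.KGraph.le_diag (p : Fin k → ℕ) : p ≤ diag k (Finset.univ.sup p) :=
  fun i => Finset.le_sup (Finset.mem_univ i)

theorem _root_.KGraph.diag_mono {m n : ℕ} (h : m ≤ n) : diag k m ≤ diag k n := fun _ => h

theorem ext_init_diag {x y : Λ.InfPath} (h : ∀ n, x.init (diag k n) = y.init (diag k n)) :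
    x = y := ext_init fun p => by
  rw [← x.pre_init (le_diag p), ← y.pre_init (le_diag p), h]

/-- The degrees `(n, …, n)` are cofinal in `ℕ^k`: `x(0, p)` is the degree-`p` prefix of any `c m`
with `p ≤ (m, …, m)`, and nesting makes the choice of `m` immaterial. -/
theorem exists_ofDiag (c : ℕ → P) (hd : ∀ n, Λ.deg (c n) = diag k n)
    (hc : ∀ n, ∃ b, Λ.IsComp (c n) b (c (n + 1))) :
    ∃ x : Λ.InfPath, ∀ n, x.init (diag k n) = c n := by
  have hmono : ∀ m n, m ≤ n → ∃ b, Λ.IsComp (c m) b (c n) := by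
    intro m n hmn
    induction n, hmn using Nat.le_induction with
    | base => exact ⟨_, isComp_one_right _⟩
    | succ n hmn ih =>
      obtain ⟨b, hb⟩ := ih
      obtain ⟨b', hb'⟩ := hc n
      obtain ⟨f, -, hf⟩ := hb.assoc_left hb'
      exact ⟨f, hf⟩
  have hpre : ∀ (p : Fin k → ℕ) (m n : ℕ), p ≤ diag k m → m ≤ n →
      Λ.pre (c n) p = Λ.pre (c m) p := by
    intro p m n hp hmn
    obtain ⟨b, hb⟩ := hmono m n hmn
    exact hb.pre_pre ((hd m).symm ▸ hp)
  refine ⟨ofInit (fun p => Λ.pre (c (Finset.univ.sup p)) p)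
    (fun p => deg_pre ((hd _).symm ▸ le_diag p)) (fun p q hpq => ?_), fun n => ?_⟩
  · have hle : Finset.univ.sup p ≤ Finset.univ.sup q :=
      Finset.sup_mono_fun fun i _ => hpq i
    rw [← hpre p _ _ (le_diag p) hle]
    exact exists_isComp_pre hpq ((hd _).symm ▸ le_diag q)
  · rw [init_ofInit]
    -- Only an inequality: for `k = 0` the supremum is `0`.
    have hle : Finset.univ.sup (diag k n) ≤ n := Finset.sup_le fun i _ => le_rfl
    rw [← hpre _ _ n (le_diag _) hle, ← hd n, pre_self]

end InfPath

/-! ### Concatenation of a finite path with an infinite path. -/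

section Concatenation

variable {k : ℕ} {V : Type u} {P : Type v} {Λ : KGraph k V P}

/-- This reduces identities between infinite paths to composites of finite ones. The case `p = 0`
recovers the initial segment `a`. -/
theorem isConcat_iff {a : P} {y z : Λ.InfPath} :
    IsConcat a y z ↔ ∀ p, Λ.IsComp a (y.init p) (z.init (Λ.deg a + p)) := by
  constructor
  · rintro ⟨h1, h2⟩ p
    have h := (InfPath.eq_shift_iff.1 h2) p
    have h1' : z.init (Λ.deg a) = a := h1
    rwa [h1'] at h
  · intro h
    have h1 : z.init (Λ.deg a) = a := by
      rw [← z.pre_init (le_self_add (b := 0))]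
      exact (h 0).pre_eq rfl
    refine ⟨h1, InfPath.eq_shift_iff.2 fun p => ?_⟩
    rw [h1]; exact h p

namespace IsConcat

variable {a b c : P} {w x y z : Λ.InfPath}

theorem init_eq (H : IsConcat a y z) : z.init (Λ.deg a) = a := H.1

theorem shift_eq (H : IsConcat a y z) : z.shift (Λ.deg a) = y := H.2

theorem rng_eq (H : IsConcat a y z) : z.rng = Λ.rng a := by
  rw [← H.init_eq, InfPath.rng_init]

theorem src_eq (H : IsConcat a y z) : Λ.src a = y.rng := by
  rw [← H.shift_eq, InfPath.rng_shift, H.init_eq]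

theorem unique (H : IsConcat a y z) (H' : IsConcat a y w) : z = w := by
  refine InfPath.ext_init fun p => ?_
  have h1 := (isConcat_iff.1 H p).unique (isConcat_iff.1 H' p)
  rw [← z.pre_init (le_add_self (b := Λ.deg a)), h1, w.pre_init le_add_self]

theorem comp_iff (hc : Λ.IsComp a b c) (hb : IsConcat b y w) :
    IsConcat c y z ↔ IsConcat a w z := by
  have h0 := hc.deg_eq
  constructor
  · intro H
    refine isConcat_iff.2 fun p => ?_
    have h1 := isConcat_iff.1 H p
    have h2 := (hc.assoc_iff (isConcat_iff.1 hb p)).1 h1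
    -- The hypothesis only describes initial segments of `z` of degree at least `d(c)`, so the
    -- segment of degree `d(a) + p` is cut out of a longer one.
    have h3 : z.init (Λ.deg a + p) = Λ.pre (z.init (Λ.deg c + p)) (Λ.deg a + p) :=
      (z.pre_init (by rw [h0, add_assoc]; gcongr; exact le_add_self)).symm
    have h4 : w.init p = Λ.pre (w.init (Λ.deg b + p)) p := (w.pre_init le_add_self).symm
    have h5 : p ≤ Λ.deg (w.init (Λ.deg b + p)) := by rw [w.deg_init]; exact le_add_self
    obtain ⟨h6, t, h7⟩ := pre_spec h5
    obtain ⟨d, h8, h9⟩ := h7.assoc_right h2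
    have h10 : Λ.deg d = Λ.deg a + p := by rw [h8.deg_eq, h6]
    rw [h3, h9.pre_eq h10, h4]
    exact h8
  · intro H
    refine isConcat_iff.2 fun p => ?_
    rw [hc.assoc_iff (isConcat_iff.1 hb p), h0, add_assoc]
    exact isConcat_iff.1 H _

theorem of_init (z : Λ.InfPath) (h : z.init (Λ.deg a) = a) : IsConcat a (z.shift (Λ.deg a)) z :=
  ⟨h, rfl⟩

theorem exists_left (H : IsConcat c y z) (hc : Λ.IsComp a b c) :
    ∃ w, IsConcat b y w ∧ IsConcat a w z := by
  have hz : z.init (Λ.deg a) = a := by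
    rw [← z.pre_init (p := Λ.deg a) (q := Λ.deg c) (by rw [hc.deg_eq]; exact le_self_add),
      H.init_eq]
    exact hc.pre_eq rfl
  refine ⟨z.shift (Λ.deg a), ⟨?_, ?_⟩, hz, rfl⟩
  · have h1 := z.isComp_init_shift (Λ.deg a) (Λ.deg b)
    rw [hz, ← hc.deg_eq, H.init_eq] at h1
    exact h1.left_cancel hc
  · rw [InfPath.shift_shift, ← hc.deg_eq, H.shift_eq]

end IsConcat

/-- The degree-`p` prefix of `a y` is cut out of `a y(0, p)`, which has degree `d(a) + p`. -/
theorem exists_isConcat {a : P} {y : Λ.InfPath} (h : Λ.src a = y.rng) : ∃ z, IsConcat a y z := by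
  have hr : ∀ p, Λ.src a = Λ.rng (y.init p) := fun p => h.trans (y.rng_init p).symm
  have hc : ∀ p, Λ.IsComp a (y.init p) (Λ.comp a (y.init p) (hr p)) := fun p => ⟨_, rfl⟩
  have hd : ∀ p, Λ.deg (Λ.comp a (y.init p) (hr p)) = Λ.deg a + p := fun p => by
    rw [Λ.deg_comp, y.deg_init]
  have hle : ∀ p, p ≤ Λ.deg (Λ.comp a (y.init p) (hr p)) := fun p => by
    rw [hd]; exact le_add_self
  have hext : ∀ p q, p ≤ q → ∃ t, Λ.IsComp (Λ.comp a (y.init p) (hr p)) t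
      (Λ.comp a (y.init q) (hr q)) := fun p q hpq =>
    ⟨_, ((hc p).assoc_iff (y.isComp_init_seg hpq)).2 (hc q)⟩
  refine ⟨InfPath.ofInit (fun p => Λ.pre (Λ.comp a (y.init p) (hr p)) p)
    (fun p => deg_pre (hle p)) (fun p q hpq => ?_), isConcat_iff.2 fun p => ?_⟩
  · obtain ⟨t, ht⟩ := hext p q hpq
    rw [← ht.pre_pre (hle p)]
    exact exists_isComp_pre hpq (hle q)
  · rw [InfPath.init_ofInit]
    obtain ⟨t, ht⟩ := hext p (Λ.deg a + p) le_add_self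
    rw [ht.pre_eq (hd p)]
    exact hc p

theorem mem_cylinder_iff {a : P} {x : Λ.InfPath} : x ∈ Λ.cylinder a ↔ x.init (Λ.deg a) = a :=
  ⟨fun ⟨_, h⟩ => h.init_eq, fun h => ⟨_, h, rfl⟩⟩

/-- Without sources a path can be prolonged by degree `(1, …, 1)` forever. -/
theorem HasNoSources.exists_rng_eq (hns : Λ.HasNoSources) (x : V) :
    ∃ y : Λ.InfPath, y.rng = x := by
  choose e he hd using fun y : V => hns y (diag k 1)
  let c : ℕ → {a // Λ.rng a = x} := fun n => Nat.rec ⟨Λ.one x, Λ.rng_one x⟩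
    (fun _ a => ⟨Λ.comp a.1 (e (Λ.src a.1)) (he _).symm, (Λ.rng_comp _ _ _).trans a.2⟩) n
  have hstep : ∀ n, Λ.IsComp (c n).1 (e (Λ.src (c n).1)) (c (n + 1)).1 := fun n => ⟨_, rfl⟩
  have hdeg : ∀ n, Λ.deg (c n).1 = diag k n := by
    intro n
    induction n with
    | zero => exact Λ.deg_one x
    | succ n ih => rw [(hstep n).deg_eq, ih, hd]; rfl
  obtain ⟨y, hy⟩ := InfPath.exists_ofDiag (Λ := Λ) (fun n => (c n).1) hdeg
    fun n => ⟨_, hstep n⟩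
  exact ⟨y, by rw [← y.rng_init (diag k 0), hy]; exact (c 0).2⟩

end Concatenation

end KGraph

/-! ### The action on infinite paths -/

/-- The inverse of an element of a groupoid. -/
abbrev GElt.inv {V : Type u} [Groupoid.{w} V] (g : GElt V) : GElt V :=
  ⟨g.cod, g.dom, Groupoid.inv g.hom⟩

namespace SelfSimilarAction

variable {k : ℕ} {V : Type u} {P : Type v} [Groupoid.{w} V] {Λ : KGraph k V P}
  (S : SelfSimilarAction Λ)

theorem smul_inv_smul (g : GElt V) (a : P) (h : Λ.rng a = g.cod) :
    S.smul g (S.smul g.inv a h) (S.rng_smul g.inv a h) = a := by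
  have h1 := S.act_comp (Groupoid.inv g.hom) g.hom ⟨a, h⟩
  rw [Groupoid.inv_comp, S.act_id] at h1
  exact (congrArg Subtype.val h1).symm

theorem isComp_smul {g : GElt V} {a b c : P} (H : Λ.IsComp a b c) (ha : Λ.rng a = g.dom)
    (hb : Λ.rng b = (S.restr g a ha).dom) (hc : Λ.rng c = g.dom) :
    Λ.IsComp (S.smul g a ha) (S.smul (S.restr g a ha) b hb) (S.smul g c hc) := by
  obtain ⟨h, rfl⟩ := H
  exact ⟨_, (S.smul_comp g a b ha h).symm⟩

/-- `actInf` moves `x(0, p)` by the restriction of `g` to `x(0, 0)`, and this removes that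
restriction: a path of degree zero is an identity, and so is its image under `g`, so both cancel. -/
theorem restr_of_deg_eq_zero {g : GElt V} {a : P} (ha : Λ.rng a = g.dom) (h : Λ.deg a = 0) :
    S.restr g a ha = g := by
  obtain ⟨h1, h2⟩ := KGraph.one_of_deg h
  obtain ⟨h3, h4⟩ := KGraph.one_of_deg ((S.deg_smul g a ha).trans h)
  rw [S.rng_smul] at h3 h4
  have hd : (S.restr g a ha).dom = g.dom := (S.dom_restr g a ha).trans (h2.trans ha)
  refine S.ext_of_smul hd ((S.cod_restr g a ha).trans h4) fun b hb => ?_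
  have hb' : Λ.rng b = g.dom := hb.trans hd
  have h5 : Λ.IsComp a b b := by
    have := KGraph.isComp_one_left (Λ := Λ) b
    rwa [hb', ← ha, ← h1] at this
  have h6 := S.isComp_smul h5 ha hb hb'
  have h7 := KGraph.isComp_one_left (Λ := Λ) (S.smul g b hb')
  rw [S.rng_smul, ← h3] at h7
  exact h6.left_cancel h7

theorem rng_actInf (g : GElt V) (x : Λ.InfPath) (hx : x.rng = g.dom) :
    (S.actInf g x hx).rng = g.cod := by
  have h := S.restr_of_deg_eq_zero (g := g) (a := x.seg 0 0 zero_le)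
    ((x.rng_seg _ _ _).trans hx) (by rw [x.deg_seg, tsub_self])
  exact congrArg GElt.cod h

theorem init_actInf (g : GElt V) (x : Λ.InfPath) (hx : x.rng = g.dom) (p : Fin k → ℕ) :
    (S.actInf g x hx).init p = S.smul g (x.init p) ((x.rng_init p).trans hx) := by
  have h := S.restr_of_deg_eq_zero (g := g) (a := x.seg 0 0 zero_le)
    ((x.rng_seg _ _ _).trans hx) (by rw [x.deg_seg, tsub_self])
  change S.smul (S.restr g (x.seg 0 0 zero_le) _) (x.seg 0 p zero_le) _ = _
  have key : ∀ (g' : GElt V) (h' : g' = g) (h1 : Λ.rng (x.init p) = g'.dom),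
      S.smul g' (x.init p) h1 = S.smul g (x.init p) ((x.rng_init p).trans hx) := by
    rintro g' rfl h1; rfl
  exact key _ h _

theorem actInf_inv (g : GElt V) (x : Λ.InfPath) (hx : x.rng = g.cod) :
    S.actInf g (S.actInf g.inv x hx) (S.rng_actInf g.inv x hx) = x := by
  refine KGraph.InfPath.ext_init fun p => ?_
  rw [init_actInf]
  simp only [S.init_actInf g.inv x hx]
  exact S.smul_inv_smul g _ _

theorem exists_actInf_eq (g : GElt V) (x : Λ.InfPath) (hx : x.rng = g.cod) :
    ∃ (y : Λ.InfPath) (hy : y.rng = g.dom), S.actInf g y hy = x :=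
  ⟨_, S.rng_actInf g.inv x hx, S.actInf_inv g x hx⟩

/-- Self-similarity passes to infinite paths: `g · (a y) = (g · a)(g|_a · y)`. -/
theorem isConcat_actInf {g : GElt V} {a : P} {y z : Λ.InfPath} (H : KGraph.IsConcat a y z)
    (ha : Λ.rng a = g.dom) (hy : y.rng = (S.restr g a ha).dom) (hz : z.rng = g.dom) :
    KGraph.IsConcat (S.smul g a ha) (S.actInf (S.restr g a ha) y hy) (S.actInf g z hz) := by
  refine KGraph.isConcat_iff.2 fun p => ?_
  rw [S.init_actInf, S.init_actInf, S.deg_smul]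
  exact S.isComp_smul (KGraph.isConcat_iff.1 H p) _ _ _

/-- Elements that act in the same way on infinite paths are equal. -/
theorem ext_of_actInf (hns : Λ.HasNoSources) {g h : GElt V} (hd : g.dom = h.dom)
    (hc : g.cod = h.cod)
    (H : ∀ (x : Λ.InfPath) (hx : x.rng = g.dom), S.actInf g x hx = S.actInf h x (hx.trans hd)) :
    g = h := by
  refine S.ext_of_smul hd hc fun a ha => ?_
  -- Any finite path is an initial segment of an infinite one, from which its image is read off.
  obtain ⟨y, hy⟩ := hns.exists_rng_eq (Λ.src a)
  obtain ⟨x, hx⟩ := KGraph.exists_isConcat hy.symm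
  have h1 := H x (hx.rng_eq.trans ha)
  have h2 := congrArg (fun z => z.init (Λ.deg a)) h1
  rw [init_actInf, init_actInf] at h2
  simp only [hx.init_eq] at h2
  exact h2

/-! ### Period pairs -/

/-- The set of those `y ∈ dom(g) Λ^∞` such that `a (g · y) = b y`. -/
def agreeSet (a : P) (g : GElt V) (b : P) : Set Λ.InfPath :=
  {y | ∃ (hy : y.rng = g.dom) (z : Λ.InfPath),
    KGraph.IsConcat a (S.actInf g y hy) z ∧ KGraph.IsConcat b y z}

theorem mem_zSet_iff {a : P} {g : GElt V} {b : P} {x : Λ.InfPath} :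
    x ∈ S.zSet a g b ↔ x.init (Λ.deg b) = b ∧ x.shift (Λ.deg b) ∈ S.agreeSet a g b := by
  constructor
  · rintro ⟨y, hy, h1, h2⟩
    refine ⟨h2.init_eq, ?_⟩
    rw [h2.shift_eq]
    exact ⟨hy, x, h1, h2⟩
  · rintro ⟨h, hy, z, h1, h2⟩
    have h3 : KGraph.IsConcat b (x.shift (Λ.deg b)) x := ⟨h, rfl⟩
    obtain rfl := h2.unique h3
    exact ⟨_, hy, h1, h3⟩

theorem isPeriodPair_iff {q : Fin k → ℕ} {a b : P} {h : GElt V} :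
    S.IsPeriodPair q a (b, h) ↔
      Λ.deg b = q ∧ ∀ x : Λ.InfPath, x.rng = h.dom → x ∈ S.agreeSet a h b :=
  and_congr_right fun _ => forall_congr' fun _ =>
    ⟨fun H hx => ⟨hx, H hx⟩, fun H hx => (H hx).2⟩

/-- Apply `σ^{d(a) + d(b)}` to `a (h · x) = b x`, removing `a` first on one side and `b` first on
the other. -/
theorem IsPeriodPair.mem_per {q : Fin k → ℕ} {a b : P} {h : GElt V}
    (H : S.IsPeriodPair q a (b, h)) : (fun i => (Λ.deg a i : ℤ) - (q i : ℤ)) ∈ S.per := by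
  obtain ⟨rfl, H⟩ := H
  refine ⟨Λ.deg a, Λ.deg b, rfl, h, fun x hx => ?_⟩
  obtain ⟨z, h1, h2⟩ := H x hx
  dsimp only at h1 h2
  rw [← h1.shift_eq, KGraph.InfPath.shift_shift, add_comm, ← KGraph.InfPath.shift_shift,
    h2.shift_eq]

/-- With `σ^{p₀}(x) = σ^{q₀}(g · x)`, choose `n = c₁ c₄ a` in `cod(g) Λ` with `d(c₁) = q₀`; strong
connectivity provides `c₄`. Let `m` be the preimage of `n` under `g`. For `x = m y` the identity
reads `m₂ y = c₄ a (g|_m · y)`, where `m₂` is `m` without its first `p₀` degrees. Removing `d(c₄)`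
from both sides leaves `b y = a (g|_m · y)`, where `b` is the last piece of `m`, of degree `q`. The
pair is `(b, g|_m)`. -/
theorem exists_isPeriodPair (hns : Λ.HasNoSources) (hsc : Λ.IsStronglyConnected)
    {q : Fin k → ℕ} {a : P} (H : (fun i => (Λ.deg a i : ℤ) - (q i : ℤ)) ∈ S.per) :
    ∃ bh, S.IsPeriodPair q a bh := by
  obtain ⟨p₀, q₀, hpq, g, hg⟩ := H
  have hadd : p₀ + q = q₀ + Λ.deg a := by
    funext i
    have := congrFun hpq i
    simp only [Pi.add_apply]
    omega
  obtain ⟨c₁, hc₁, hd₁⟩ := hns g.cod q₀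
  obtain ⟨c₂, hc₂, hd₂⟩ := hns (Λ.src c₁) p₀
  obtain ⟨c₃, hc₃, hs₃⟩ := hsc (Λ.src c₂) (Λ.rng a)
  have h23 := KGraph.isComp_comp c₂ c₃ hc₃.symm
  set c₄ := Λ.comp c₂ c₃ hc₃.symm
  have h4a := KGraph.isComp_comp c₄ a (h23.src_eq.trans hs₃)
  set c₅ := Λ.comp c₄ a (h23.src_eq.trans hs₃)
  have h15 := KGraph.isComp_comp c₁ c₅ (by rw [h4a.rng_eq, h23.rng_eq, hc₂])
  set n := Λ.comp c₁ c₅ (by rw [h4a.rng_eq, h23.rng_eq, hc₂])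
  have hn : Λ.rng n = g.cod := h15.rng_eq.trans hc₁
  set m := S.smul g.inv n hn with hm
  have hmr : Λ.rng m = g.dom := S.rng_smul g.inv n hn
  have hgm : S.smul g m hmr = n := S.smul_inv_smul g n hn
  have hmd : Λ.deg m = p₀ + (Λ.deg c₄ + q) := by
    rw [hm, S.deg_smul, h15.deg_eq, h4a.deg_eq, hd₁, add_left_comm, ← hadd]
    abel
  obtain ⟨m₁, m₂, hm₁, hm₂, hm12⟩ := KGraph.exists_isComp hmd
  obtain ⟨m₃, b, hm₃, hb, hm3b⟩ := KGraph.exists_isComp hm₂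
  refine ⟨(b, S.restr g m hmr), S.isPeriodPair_iff.2 ⟨hb, fun y hy => ⟨hy, ?_⟩⟩⟩
  have hy' : Λ.src m = y.rng := (hy.trans (S.dom_restr g m hmr)).symm
  obtain ⟨x, hx⟩ := KGraph.exists_isConcat hy'
  have hxr : x.rng = g.dom := hx.rng_eq.trans hmr
  have h1 := hg x hxr
  have h2 := S.isConcat_actInf hx hmr hy hxr
  rw [hgm] at h2
  obtain ⟨w₁, hw₁, hw₁'⟩ := hx.exists_left hm12
  obtain ⟨w₂, hw₂, hw₂'⟩ := hw₁.exists_left hm3b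
  obtain ⟨u₁, hu₁, hu₁'⟩ := h2.exists_left h15
  obtain ⟨u₂, hu₂, hu₂'⟩ := hu₁.exists_left h4a
  have hwu : w₁ = u₁ := by
    rw [← hw₁'.shift_eq, ← hu₁'.shift_eq, hm₁, hd₁]; exact h1
  refine ⟨w₂, ?_, hw₂⟩
  have : w₂ = u₂ := by
    rw [← hw₂'.shift_eq, ← hu₂'.shift_eq, hwu, hm₃]
  rwa [this]

theorem periodPair_spec (hns : Λ.HasNoSources) (hsc : Λ.IsStronglyConnected)
    {q : Fin k → ℕ} {a : P} (H : (fun i => (Λ.deg a i : ℤ) - (q i : ℤ)) ∈ S.per) :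
    S.IsPeriodPair q a (S.theta q a, S.hElt q a) := by
  have h := S.exists_isPeriodPair hns hsc H
  rw [theta, hElt, periodPair, dif_pos h]
  exact h.choose_spec

section PeriodPair

variable {q : Fin k → ℕ} {a b : P} {h : GElt V}

theorem IsPeriodPair.dom_eq (hns : Λ.HasNoSources) (H : S.IsPeriodPair q a (b, h)) :
    h.dom = Λ.src b := by
  obtain ⟨x, hx⟩ := hns.exists_rng_eq h.dom
  obtain ⟨z, -, h2⟩ := H.2 x hx
  exact (h2.src_eq.trans hx).symm

theorem IsPeriodPair.cod_eq (hns : Λ.HasNoSources) (H : S.IsPeriodPair q a (b, h)) :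
    h.cod = Λ.src a := by
  obtain ⟨x, hx⟩ := hns.exists_rng_eq h.dom
  obtain ⟨z, h1, -⟩ := H.2 x hx
  exact (h1.src_eq.trans (S.rng_actInf _ _ _)).symm

/-- If `(b, h)` is a period pair of `a`, then `Z(a) ⊆ Z(b)`. -/
theorem IsPeriodPair.init_eq (hns : Λ.HasNoSources) (H : S.IsPeriodPair q a (b, h))
    {y z : Λ.InfPath} (hz : KGraph.IsConcat a y z) : z.init q = b := by
  -- `h` maps onto the infinite paths with range `s(a)`, so every tail `y` has the form `h · x`.
  obtain ⟨x, hx, rfl⟩ := S.exists_actInf_eq h y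
    (hz.src_eq.symm.trans (H.cod_eq S hns).symm)
  obtain ⟨z', h1, h2⟩ := H.2 x hx
  rw [hz.unique h1, ← H.1]
  exact h2.init_eq

/-- The common value `a (g · y) = b y` starts with `a`, hence with `θ(a)`, which has the same degree
as its other prefix `b`. -/
theorem eq_theta_of_nonempty (hns : Λ.HasNoSources) (hsc : Λ.IsStronglyConnected)
    {g : GElt V} (H : (fun i => (Λ.deg a i : ℤ) - (Λ.deg b i : ℤ)) ∈ S.per)
    (hne : (S.agreeSet a g b).Nonempty) : b = S.theta (Λ.deg b) a := by
  obtain ⟨y, hy, z, h1, h2⟩ := hne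
  rw [← (S.periodPair_spec hns hsc H).init_eq S hns h1]
  exact h2.init_eq.symm

end PeriodPair

/-- Elements of `agreeSet` below a path: the tails lie in a set of the same form. -/
theorem exists_shift_mem_agreeSet {a b : P} {g : GElt V} {y : Λ.InfPath} {n : Fin k → ℕ}
    (hy : y.rng = g.dom) (hab : Λ.src b = y.rng) (hac : Λ.src a = g.cod) :
    ∃ a' b', Λ.deg a' = Λ.deg a ∧ Λ.deg b' = Λ.deg b ∧ Λ.src b' = Λ.src (y.init n) ∧
      ∀ x (_ : x ∈ S.agreeSet a g b), x.init n = y.init n →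
        x.shift n ∈ S.agreeSet a' (S.restr g (y.init n) ((y.rng_init n).trans hy)) b' := by
  set v := y.init n with hv
  have hvr : Λ.rng v = g.dom := (y.rng_init n).trans hy
  have hvd : Λ.deg v = n := y.deg_init n
  -- For `x = v x'` the relation becomes `b v x' = a (g · v)(g|_v · x')`. Writing `b v = b₁ b'` and
  -- `a (g · v) = a₁ a'` with `d(b₁) = d(a₁) = n` and deleting the first `n` degrees gives `b' x' =
  -- a' (g|_v · x')`.
  have hbv := KGraph.isComp_comp b v (hab.trans (y.rng_init n).symm)
  have hav := KGraph.isComp_comp a (S.smul g v hvr) (hac.trans (S.rng_smul _ _ _).symm)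
  obtain ⟨b₁, b', hb₁, hb', hb⟩ := KGraph.exists_isComp
    (hbv.deg_eq.trans ((add_comm _ _).trans (congrArg (· + _) hvd)))
  obtain ⟨a₁, a', ha₁, ha', ha⟩ := KGraph.exists_isComp
    (hav.deg_eq.trans ((add_comm _ _).trans (congrArg (· + _) ((S.deg_smul g v hvr).trans hvd))))
  refine ⟨a', b', ha', hb', by rw [← hb.src_eq, hbv.src_eq], ?_⟩
  rintro x ⟨hx, z, h1, h2⟩ hxv
  have hxc : KGraph.IsConcat v (x.shift n) x := by
    rw [← hvd]; exact KGraph.IsConcat.of_init x (by rw [hvd, hxv])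
  have hd : (x.shift n).rng = (S.restr g v hvr).dom := by
    rw [x.rng_shift, S.dom_restr, hxv]
  have h3 := S.isConcat_actInf hxc hvr hd hx
  have h4 := (KGraph.IsConcat.comp_iff hbv hxc).2 h2
  have h5 := (KGraph.IsConcat.comp_iff hav h3).2 h1
  obtain ⟨w₁, hw₁, hw₁'⟩ := h4.exists_left hb
  obtain ⟨w₂, hw₂, hw₂'⟩ := h5.exists_left ha
  have hw : w₁ = w₂ := by rw [← hw₁'.shift_eq, ← hw₂'.shift_eq, hb₁, ha₁]
  subst hw
  exact ⟨hd, w₁, hw₂, hw₁⟩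

/-! ### Finiteness of the sets of restrictions -/

theorem smul_unit (x : V) (a : P) (ha : Λ.rng a = (GElt.unit x).dom) :
    S.smul (GElt.unit x) a ha = a :=
  congrArg Subtype.val (S.act_id x ⟨a, ha⟩)

theorem restr_unit (x : V) (a : P) (ha : Λ.rng a = (GElt.unit x).dom) :
    S.restr (GElt.unit x) a ha = GElt.unit (Λ.src a) := by
  have hd : (S.restr (GElt.unit x) a ha).dom = (GElt.unit (Λ.src a)).dom := S.dom_restr _ _ _
  have hc : (S.restr (GElt.unit x) a ha).cod = (GElt.unit (Λ.src a)).cod := by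
    rw [S.cod_restr, S.smul_unit]; rfl
  refine S.ext_of_smul hd hc fun b hb => ?_
  have hab := KGraph.isComp_comp a b (hb.trans hd).symm
  have h1 := S.isComp_smul hab ha hb (hab.rng_eq.trans ha)
  rw [S.smul_unit, S.smul_unit] at h1
  rw [h1.left_cancel hab, S.smul_unit]

/-- The finite-state condition exempts units, but restrictions of units are units, and there are
finitely many vertices. -/
theorem IsFiniteState.finite_restr [Finite V] (hfs : S.IsFiniteState) (g : GElt V) :
    {h | ∃ a ha, S.restr g a ha = h}.Finite := by
  by_cases hg : ∀ x, g ≠ GElt.unit x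
  · exact hfs g hg
  · push Not at hg
    obtain ⟨x, rfl⟩ := hg
    refine (Set.finite_range (GElt.unit (V := V))).subset ?_
    rintro _ ⟨a, ha, rfl⟩
    exact ⟨Λ.src a, (S.restr_unit x a ha).symm⟩

end SelfSimilarAction

/-! ### Perron-Frobenius theory -/

section Perron

variable {V : Type u} [Fintype V]

/-- A matrix with positive entries sends a non-zero non-negative vector to a positive vector. -/
theorem Matrix.mulVec_pos_of_pos {A : Matrix V V ℝ} (hA : ∀ i j, 0 < A i j) {x : V → ℝ}
    (hx : ∀ i, 0 ≤ x i) (hx0 : x ≠ 0) (i : V) : 0 < A.mulVec x i := by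
  obtain ⟨j, hj⟩ := Function.ne_iff.1 hx0
  exact Finset.sum_pos' (fun j _ => mul_nonneg (hA i j).le (hx j))
    ⟨j, Finset.mem_univ j, mul_pos (hA i j) ((hx j).lt_of_ne' hj)⟩

/-- The Perron theorem: a matrix with positive entries has a positive eigenvector, and the
corresponding eigenspace is one-dimensional. -/
theorem Matrix.exists_pos_eigenvector_of_pos [Nonempty V] [DecidableEq V] {A : Matrix V V ℝ}
    (hA : ∀ i j, 0 < A i j) :
    ∃ (x : V → ℝ) (r : ℝ), (∀ i, 0 < x i) ∧ A.mulVec x = r • x ∧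
      ∀ y, A.mulVec y = r • y → ∃ c : ℝ, y = c • x := by
  -- Collatz-Wielandt: maximise `t` over the pairs with `t x ≤ A x`, `x` in the simplex.
  let T : Set (ℝ × (V → ℝ)) :=
    {z | 0 ≤ z.1 ∧ z.2 ∈ stdSimplex ℝ V ∧ ∀ i, z.1 * z.2 i ≤ A.mulVec z.2 i}
  have hbound : ∀ z ∈ T, z.1 ≤ ∑ i, ∑ j, A i j := by
    rintro ⟨t, x⟩ ⟨-, hx, h⟩
    calc t = ∑ i, t * x i := by rw [← Finset.mul_sum, hx.2, mul_one]
      _ ≤ ∑ i, A.mulVec x i := Finset.sum_le_sum fun i _ => h i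
      _ ≤ ∑ i, ∑ j, A i j := by
        refine Finset.sum_le_sum fun i _ => Finset.sum_le_sum fun j _ => ?_
        refine mul_le_of_le_one_right (hA i j).le ?_
        rw [← hx.2]
        exact Finset.single_le_sum (fun i _ => hx.1 i) (Finset.mem_univ j)
  have hcont : ∀ i, Continuous fun z : ℝ × (V → ℝ) => A.mulVec z.2 i := fun i =>
    (continuous_apply i).comp (Continuous.matrix_mulVec continuous_const continuous_snd)
  have hT : IsCompact T := by
    have h1 : IsCompact (Set.Icc (0 : ℝ) (∑ i, ∑ j, A i j) ×ˢ stdSimplex ℝ V) :=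
      isCompact_Icc.prod (isCompact_stdSimplex ℝ V)
    have h2 : IsClosed {z : ℝ × (V → ℝ) | ∀ i, z.1 * z.2 i ≤ A.mulVec z.2 i} := by
      simp only [Set.ofPred_forall]
      exact isClosed_iInter fun i => isClosed_le
        (continuous_fst.mul ((continuous_apply i).comp continuous_snd)) (hcont i)
    convert h1.inter_right h2 using 1
    ext z
    constructor
    · intro hz
      exact ⟨⟨⟨hz.1, hbound z hz⟩, hz.2.1⟩, hz.2.2⟩
    · rintro ⟨⟨⟨h3, -⟩, h4⟩, h5⟩
      exact ⟨h3, h4, h5⟩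
  obtain ⟨i₀⟩ := ‹Nonempty V›
  have hne : T.Nonempty := ⟨(0, Pi.single i₀ 1), le_rfl, single_mem_stdSimplex ℝ i₀, fun i => by
    rw [zero_mul]
    exact Finset.sum_nonneg fun j _ => mul_nonneg (hA i j).le
      ((single_mem_stdSimplex ℝ i₀).1 j)⟩
  obtain ⟨⟨r, x⟩, ⟨hr, hx, hrx⟩, hmax⟩ := hT.exists_isMaxOn hne continuous_fst.continuousOn
  dsimp only at hr hx hrx
  have hx0 : x ≠ 0 := by
    rintro rfl
    simpa using hx.2
  have hAx := Matrix.mulVec_pos_of_pos hA hx.1 hx0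
  have heig : A.mulVec x = r • x := by
    by_contra hcon
    have hd0 : A.mulVec x - r • x ≠ 0 := sub_ne_zero.2 hcon
    -- If `A x - r x` is nonzero, then `A` makes it positive in every coordinate, so the normalised
    -- vector `A x` admits some `t > r`, against maximality.
    have hAd := Matrix.mulVec_pos_of_pos hA (x := A.mulVec x - r • x)
      (fun i => sub_nonneg.2 (hrx i)) hd0
    have h1 : ∀ i, r * A.mulVec x i < A.mulVec (A.mulVec x) i := fun i => by
      have := hAd i
      rw [Matrix.mulVec_sub, Matrix.mulVec_smul] at this
      exact sub_pos.1 this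
    have h2 : ∀ᶠ t in 𝓝[>] r, ∀ i, t * A.mulVec x i < A.mulVec (A.mulVec x) i := by
      refine Filter.eventually_all.2 fun i => nhdsWithin_le_nhds ?_
      exact (continuous_id.mul continuous_const).continuousAt.eventually_lt_const (h1 i)
    obtain ⟨t, ht, htr⟩ := (h2.and self_mem_nhdsWithin).exists
    have hs : 0 < ∑ i, A.mulVec x i := Finset.sum_pos (fun i _ => hAx i) ⟨i₀, Finset.mem_univ _⟩
    have hmem : (t, (∑ i, A.mulVec x i)⁻¹ • A.mulVec x) ∈ T := by
      refine ⟨hr.trans (le_of_lt htr), ⟨fun i => ?_, ?_⟩, fun i => ?_⟩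
      · exact mul_nonneg (inv_nonneg.2 hs.le) (hAx i).le
      · simp only [Pi.smul_apply, smul_eq_mul]
        rw [← Finset.mul_sum, inv_mul_cancel₀ hs.ne']
      · rw [Matrix.mulVec_smul]
        simp only [Pi.smul_apply, smul_eq_mul]
        rw [mul_left_comm]
        exact mul_le_mul_of_nonneg_left (ht i).le (inv_nonneg.2 hs.le)
    exact absurd (hmax hmem) (not_le.2 htr)
  have hrpos : ∀ i, 0 < x i := fun i => by
    have h1 := hAx i
    rw [heig] at h1
    exact pos_of_mul_pos_right h1 hr
  refine ⟨x, r, hrpos, heig, fun y hy => ?_⟩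
  have : Nonempty V := ⟨i₀⟩
  -- Subtract from `y` the largest multiple of `x` that leaves a non-negative vector. The rest
  -- vanishes at `j`, and so does its image under `A`; by positivity of `A` the rest is zero.
  obtain ⟨j, hj⟩ := Finite.exists_min fun i => y i / x i
  refine ⟨y j / x j, ?_⟩
  by_contra hcon
  have hz := Matrix.mulVec_pos_of_pos hA (x := y - (y j / x j) • x)
    (fun i => sub_nonneg.2 ((le_div_iff₀ (hrpos i)).1 (hj i))) (sub_ne_zero.2 hcon) j
  rw [Matrix.mulVec_sub, Matrix.mulVec_smul, hy, heig] at hz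
  simp only [Pi.sub_apply, Pi.smul_apply, smul_eq_mul] at hz
  have h3 : y j / x j * (r * x j) = r * y j := by
    field_simp [(hrpos j).ne']
  rw [h3, sub_self] at hz
  exact lt_irrefl _ hz

/-- The spectral radius of a non-negative matrix with a positive eigenvector. -/
theorem Matrix.spectralRadius_of_pos_eigenvector [Nonempty V] [DecidableEq V] {B : Matrix V V ℝ}
    (hB : ∀ i j, 0 ≤ B i j) {x : V → ℝ} (hx : ∀ i, 0 < x i) {t : ℝ} (ht : B.mulVec x = t • x) :
    (spectralRadius ℂ (B.map (fun s : ℝ => (s : ℂ)))).toReal = t := by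
  have hmem : ∀ μ : ℂ, μ ∈ spectrum ℂ (B.map (fun s : ℝ => (s : ℂ))) ↔
      ∃ u : V → ℂ, u ≠ 0 ∧ (B.map (fun s : ℝ => (s : ℂ))).mulVec u = μ • u := by
    intro μ
    rw [← Matrix.spectrum_toLin', ← Module.End.hasEigenvalue_iff_mem_spectrum]
    constructor
    · intro h
      obtain ⟨u, hu⟩ := h.exists_hasEigenvector
      exact ⟨u, hu.2, by simpa using hu.apply_eq_smul⟩
    · rintro ⟨u, hu, h⟩
      exact Module.End.hasEigenvalue_of_hasEigenvector
        (Module.End.hasEigenvector_iff.2 ⟨Module.End.mem_eigenspace_iff.2 (by simpa using h), hu⟩)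
  obtain ⟨i₀⟩ := ‹Nonempty V›
  have ht0 : 0 ≤ t := by
    have h1 : 0 ≤ t * x i₀ := by
      have h2 := congrFun ht i₀
      rw [Pi.smul_apply, smul_eq_mul] at h2
      rw [← h2]
      exact Finset.sum_nonneg fun j _ => mul_nonneg (hB i₀ j) (hx j).le
    exact nonneg_of_mul_nonneg_left h1 (hx i₀)
  have hle : ∀ μ ∈ spectrum ℂ (B.map (fun s : ℝ => (s : ℂ))), ‖μ‖ ≤ t := by
    intro μ hμ
    obtain ⟨u, hu, h⟩ := (hmem μ).1 hμ
    have : Nonempty V := ⟨i₀⟩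
    -- At the index where `‖u i‖ / x i` is largest, the triangle inequality and `B x = t x` give
    -- `‖μ‖ ‖u j‖ ≤ t ‖u j‖`.
    obtain ⟨j, hj⟩ := Finite.exists_max fun i => ‖u i‖ / x i
    have hj' : ∀ i, ‖u i‖ ≤ ‖u j‖ / x j * x i := fun i => (div_le_iff₀ (hx i)).1 (hj i)
    have huj : 0 < ‖u j‖ := by
      by_contra hcon
      have h0 : ‖u j‖ = 0 := le_antisymm (not_lt.1 hcon) (norm_nonneg _)
      refine hu (funext fun i => ?_)
      have := hj' i
      rw [h0, zero_div, zero_mul] at this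
      exact norm_le_zero_iff.1 this
    have h1 : ‖μ‖ * ‖u j‖ ≤ t * ‖u j‖ := by
      calc ‖μ‖ * ‖u j‖ = ‖(B.map (fun s : ℝ => (s : ℂ))).mulVec u j‖ := by
            rw [h, Pi.smul_apply, smul_eq_mul, norm_mul]
        _ ≤ ∑ i, ‖(B j i : ℂ) * u i‖ := norm_sum_le _ _
        _ ≤ ∑ i, ‖u j‖ / x j * (B j i * x i) := by
            refine Finset.sum_le_sum fun i _ => ?_
            rw [norm_mul, Complex.norm_real, Real.norm_of_nonneg (hB j i), mul_left_comm]
            exact mul_le_mul_of_nonneg_left (hj' i) (hB j i)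
        _ = ‖u j‖ / x j * (t * x j) := by
            rw [← Finset.mul_sum]
            have h2 := congrFun ht j
            rw [Pi.smul_apply, smul_eq_mul] at h2
            rw [← h2]; rfl
        _ = t * ‖u j‖ := by field_simp [(hx j).ne']
    exact le_of_mul_le_mul_right h1 huj
  have htm : (t : ℂ) ∈ spectrum ℂ (B.map (fun s : ℝ => (s : ℂ))) := by
    refine (hmem _).2 ⟨fun i => (x i : ℂ), fun h0 => ?_, ?_⟩
    · exact (hx i₀).ne' (Complex.ofReal_eq_zero.1 (congrFun h0 i₀))
    · funext i
      have h2 := congrFun ht i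
      simp only [Matrix.mulVec, dotProduct, Pi.smul_apply, smul_eq_mul, Matrix.map_apply] at h2 ⊢
      rw [← Complex.ofReal_mul, ← h2, Complex.ofReal_sum]
      simp only [Complex.ofReal_mul]
  have hrad : spectralRadius ℂ (B.map (fun s : ℝ => (s : ℂ))) = ENNReal.ofReal t := by
    refine le_antisymm (iSup₂_le fun μ hμ => ?_) ?_
    · change ‖μ‖ₑ ≤ _
      rw [← ofReal_norm]
      exact ENNReal.ofReal_le_ofReal (hle μ hμ)
    · refine le_trans (le_of_eq ?_) (le_iSup₂ (f := fun μ _ => (‖μ‖ₑ : ENNReal)) (t : ℂ) htm)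
      rw [← ofReal_norm, Complex.norm_real, Real.norm_of_nonneg ht0]
  rw [hrad, ENNReal.toReal_ofReal ht0]

end Perron

/-! ### Path matrices and the Perron-Frobenius vector -/

namespace KGraph

section Paths

variable {k : ℕ} {V : Type u} {P : Type v} {Λ : KGraph k V P}

open Classical in
/-- The finite set `x Λ^p`. -/
noncomputable def IsFinite.paths (hfin : Λ.IsFinite) (x : V) (p : Fin k → ℕ) : Finset P :=
  (hfin p).toFinset.filter fun a => Λ.rng a = x

theorem IsFinite.mem_paths (hfin : Λ.IsFinite) {x : V} {p : Fin k → ℕ} {a : P} :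
    a ∈ hfin.paths x p ↔ Λ.deg a = p ∧ Λ.rng a = x := by
  classical
  rw [IsFinite.paths, Finset.mem_filter, Set.Finite.mem_toFinset, Set.mem_ofPred_eq]

/-- Summation over the extensions of a path. -/
theorem IsFinite.sum_filter_pre (hfin : Λ.IsFinite) {a : P} {p q : Fin k → ℕ} [DecidableEq P]
    (hp : Λ.deg a = p) (f : V → ℝ) :
    ∑ c ∈ (hfin.paths (Λ.rng a) (p + q)).filter (fun c => Λ.pre c p = a), f (Λ.src c)
      = ∑ b ∈ hfin.paths (Λ.src a) q, f (Λ.src b) := by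
  symm
  have hr : ∀ b ∈ hfin.paths (Λ.src a) q, Λ.src a = Λ.rng b := fun b hb =>
    (hfin.mem_paths.1 hb).2.symm
  refine Finset.sum_bij (fun b hb => Λ.comp a b (hr b hb)) ?_ ?_ ?_ ?_
  · intro b hb
    have h := isComp_comp a b (hr b hb)
    rw [Finset.mem_filter, hfin.mem_paths, h.deg_eq, hp, (hfin.mem_paths.1 hb).1]
    exact ⟨⟨rfl, h.rng_eq⟩, h.pre_eq hp⟩
  · intro b hb b' hb' e
    exact comp_left_cancel _ _ e
  · intro c hc
    obtain ⟨h1, h2⟩ := Finset.mem_filter.1 hc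
    obtain ⟨h3, h4⟩ := hfin.mem_paths.1 h1
    obtain ⟨-, b, hb⟩ := pre_spec (Λ := Λ) (c := c) (m := p) (by rw [h3]; exact le_self_add)
    rw [h2] at hb
    have h5 := hb.deg_eq
    rw [h3, hp] at h5
    exact ⟨b, hfin.mem_paths.2 ⟨(add_left_cancel h5).symm, hb.src_left.symm⟩, hb.2⟩
  · intro b hb
    rw [(isComp_comp a b (hr b hb)).src_eq]

theorem IsFinite.sum_paths_add (hfin : Λ.IsFinite) (x : V) (p q : Fin k → ℕ) (f : V → ℝ) :
    ∑ c ∈ hfin.paths x (p + q), f (Λ.src c)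
      = ∑ a ∈ hfin.paths x p, ∑ b ∈ hfin.paths (Λ.src a) q, f (Λ.src b) := by
  classical
  rw [← Finset.sum_fiberwise_of_maps_to (s := hfin.paths x (p + q)) (t := hfin.paths x p)
    (g := fun c => Λ.pre c p)]
  · refine Finset.sum_congr rfl fun a ha => ?_
    obtain ⟨h1, rfl⟩ := hfin.mem_paths.1 ha
    exact hfin.sum_filter_pre h1 f
  · intro c hc
    obtain ⟨h1, h2⟩ := hfin.mem_paths.1 hc
    have hle : p ≤ Λ.deg c := by rw [h1]; exact le_self_add
    exact hfin.mem_paths.2 ⟨deg_pre hle, (rng_pre hle).trans h2⟩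

/-- The matrix `B_p(v, w) = |v Λ^p w|`. -/
noncomputable def pathMat (Λ : KGraph k V P) (p : Fin k → ℕ) : Matrix V V ℝ :=
  fun x y => ({a | Λ.rng a = x ∧ Λ.src a = y ∧ Λ.deg a = p}.ncard : ℝ)

theorem pathMat_single (i : Fin k) : Λ.pathMat (Pi.single i 1) = Λ.adj i := rfl

theorem pathMat_nonneg (p : Fin k → ℕ) (x y : V) : 0 ≤ Λ.pathMat p x y := Nat.cast_nonneg _

theorem IsFinite.one_le_pathMat (hfin : Λ.IsFinite) (a : P) :
    1 ≤ Λ.pathMat (Λ.deg a) (Λ.rng a) (Λ.src a) := by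
  refine Nat.one_le_cast.2 ((Set.ncard_pos ((hfin (Λ.deg a)).subset ?_)).2 ⟨a, rfl, rfl, rfl⟩)
  exact fun b hb => hb.2.2

variable [Fintype V]

theorem IsFinite.pathMat_mulVec (hfin : Λ.IsFinite) (p : Fin k → ℕ) (f : V → ℝ) (x : V) :
    (Λ.pathMat p).mulVec f x = ∑ a ∈ hfin.paths x p, f (Λ.src a) := by
  classical
  rw [← Finset.sum_fiberwise_of_maps_to (s := hfin.paths x p) (t := Finset.univ)
    (g := Λ.src) (fun _ _ => Finset.mem_univ _)]
  refine Finset.sum_congr rfl fun y _ => ?_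
  rw [Finset.sum_congr rfl (g := fun _ => f y)
    (fun a ha => by rw [(Finset.mem_filter.1 ha).2]), Finset.sum_const, nsmul_eq_mul,
    ← Set.ncard_coe_finset]
  refine congrArg (fun s : Set P => (s.ncard : ℝ) * f y) ?_
  ext a
  simp only [Set.mem_ofPred_eq, Finset.coe_filter, hfin.mem_paths]
  tauto

/-- Splitting a path of degree `p + q` after degree `p` shows that both sides act alike on every
vector. -/
theorem IsFinite.pathMat_add (hfin : Λ.IsFinite) (p q : Fin k → ℕ) :
    Λ.pathMat (p + q) = Λ.pathMat p * Λ.pathMat q := by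
  refine Matrix.mulVec_injective (funext fun f => funext fun x => ?_)
  rw [← Matrix.mulVec_mulVec, hfin.pathMat_mulVec, hfin.sum_paths_add, hfin.pathMat_mulVec]
  exact Finset.sum_congr rfl fun a _ => (hfin.pathMat_mulVec _ _ _).symm

theorem IsFinite.pathMat_zero_mulVec (hfin : Λ.IsFinite) (f : V → ℝ) :
    (Λ.pathMat 0).mulVec f = f := by
  funext x
  rw [hfin.pathMat_mulVec, Finset.sum_eq_single (Λ.one x), Λ.src_one]
  · intro a ha hne
    obtain ⟨h1, h2⟩ := hfin.mem_paths.1 ha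
    exact absurd (h2 ▸ eq_one_of_deg_eq_zero h1) hne
  · intro h
    exact absurd (hfin.mem_paths.2 ⟨Λ.deg_one x, Λ.rng_one x⟩) h

theorem pathMat_mulVec_pos (hfin : Λ.IsFinite) (hns : Λ.HasNoSources) {f : V → ℝ}
    (hf : ∀ x, 0 < f x) (p : Fin k → ℕ) (x : V) : 0 < (Λ.pathMat p).mulVec f x := by
  rw [hfin.pathMat_mulVec]
  obtain ⟨a, ha, hd⟩ := hns x p
  exact Finset.sum_pos (fun a _ => hf _) ⟨a, hfin.mem_paths.2 ⟨hd, ha⟩⟩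

variable [DecidableEq V]

/-- Choosing one path for each pair of vertices and adding the path matrices of their degrees gives
a positive matrix. It commutes with every `B_i`, so each `B_i` preserves its one-dimensional Perron
eigenspace; since `x` is positive, the eigenvalue of `B_i` is its spectral radius. -/
theorem exists_isPFVector [Nonempty V] (hfin : Λ.IsFinite) (hsc : Λ.IsStronglyConnected) :
    ∃ x, Λ.IsPFVector x := by
  classical
  choose c hcr hcs using hsc
  let F : Finset (Fin k → ℕ) := Finset.univ.image fun z : V × V => Λ.deg (c z.1 z.2)
  have hA : ∀ x y, 0 < (∑ p ∈ F, Λ.pathMat p) x y := fun x y => by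
    rw [Matrix.sum_apply]
    refine Finset.sum_pos' (fun p _ => pathMat_nonneg p x y)
      ⟨Λ.deg (c x y), Finset.mem_image.2 ⟨(x, y), Finset.mem_univ _, rfl⟩, ?_⟩
    have := hfin.one_le_pathMat (c x y)
    rw [hcr, hcs] at this
    exact zero_lt_one.trans_le this
  obtain ⟨x, r, hx, hxr, hsimple⟩ := Matrix.exists_pos_eigenvector_of_pos hA
  have hcomm : ∀ i, ∃ t : ℝ, (Λ.adj i).mulVec x = t • x := fun i => by
    refine hsimple _ ?_
    rw [← pathMat_single, Matrix.mulVec_mulVec, Finset.sum_mul, Finset.sum_congr rfl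
      (fun p _ => (hfin.pathMat_add p (Pi.single i 1)).symm.trans
        ((congrArg Λ.pathMat (add_comm p _)).trans (hfin.pathMat_add _ _))),
      ← Finset.mul_sum, ← Matrix.mulVec_mulVec, hxr, Matrix.mulVec_smul]
  have hrho : ∀ i, (Λ.adj i).mulVec x = Λ.rho i • x := fun i => by
    obtain ⟨t, ht⟩ := hcomm i
    have hB : ∀ y z, 0 ≤ Λ.adj i y z := pathMat_nonneg (Pi.single i 1)
    rw [rho, Matrix.spectralRadius_of_pos_eigenvector hB hx ht, ht]
  have hs : 0 < ∑ y, x y := Finset.sum_pos (fun y _ => hx y) Finset.univ_nonempty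
  refine ⟨(∑ y, x y)⁻¹ • x, fun y => mul_pos (inv_pos.2 hs) (hx y), ?_, fun i => ?_⟩
  · simp only [Pi.smul_apply, smul_eq_mul, abs_of_pos (mul_pos (inv_pos.2 hs) (hx _))]
    rw [← Finset.mul_sum, inv_mul_cancel₀ hs.ne']
  · rw [Matrix.mulVec_smul, hrho, smul_comm]

theorem isPFVector_pfVector [Nonempty V] (hfin : Λ.IsFinite) (hsc : Λ.IsStronglyConnected) :
    Λ.IsPFVector Λ.pfVector := by
  have h := exists_isPFVector hfin hsc
  rw [pfVector, dif_pos h]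
  exact h.choose_spec

theorem rhoPow_add (p q : Fin k → ℕ) : Λ.rhoPow (p + q) = Λ.rhoPow p * Λ.rhoPow q := by
  simp only [rhoPow, Pi.add_apply, pow_add, Finset.prod_mul_distrib]

theorem rhoPow_zero : Λ.rhoPow 0 = 1 := by
  simp [rhoPow]

theorem rhoPow_single (i : Fin k) : Λ.rhoPow (Pi.single i 1) = Λ.rho i := by
  rw [rhoPow, Finset.prod_eq_single i]
  · simp
  · intro j _ hj; simp [Pi.single_eq_of_ne hj]
  · simp

namespace IsPFVector

variable {x : V → ℝ}

theorem pathMat_mulVec (H : Λ.IsPFVector x) (hfin : Λ.IsFinite) (p : Fin k → ℕ) :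
    (Λ.pathMat p).mulVec x = Λ.rhoPow p • x := by
  have key : ∀ (n : ℕ) (p : Fin k → ℕ), ∑ i, p i = n →
      (Λ.pathMat p).mulVec x = Λ.rhoPow p • x := by
    intro n
    induction n with
    | zero =>
      intro p hp
      have h0 : p = 0 := funext fun i => (Finset.sum_eq_zero_iff.1 hp) i (Finset.mem_univ i)
      rw [h0, hfin.pathMat_zero_mulVec, rhoPow_zero, one_smul]
    | succ n ih =>
      intro p hp
      obtain ⟨i, hi⟩ : ∃ i, p i ≠ 0 := by
        by_contra hcon
        push Not at hcon
        simp [hcon] at hp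
      have hle : Pi.single i 1 ≤ p := by
        intro j
        by_cases hj : j = i
        · subst hj; simpa using Nat.one_le_iff_ne_zero.2 hi
        · simp [Pi.single_eq_of_ne hj]
      obtain ⟨q, rfl⟩ := exists_add_of_le hle
      have hq : ∑ j, q j = n := by
        simp only [Pi.add_apply, Finset.sum_add_distrib, Finset.sum_pi_single'] at hp
        simp at hp
        omega
      rw [hfin.pathMat_add, ← Matrix.mulVec_mulVec, ih q hq, Matrix.mulVec_smul, pathMat_single,
        H.2.2 i, rhoPow_add, rhoPow_single, smul_smul, mul_comm]
  exact key _ p rfl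

theorem sum_paths (H : Λ.IsPFVector x) (hfin : Λ.IsFinite) (y : V) (p : Fin k → ℕ) :
    ∑ a ∈ hfin.paths y p, x (Λ.src a) = Λ.rhoPow p * x y := by
  rw [← hfin.pathMat_mulVec, H.pathMat_mulVec hfin]; rfl

/-- `ρ(Λ)^p x(y)` is the sum of `x(s(a))` over `y Λ^p`, which is non-empty. -/
theorem rhoPow_pos [Nonempty V] (H : Λ.IsPFVector x) (hfin : Λ.IsFinite)
    (hns : Λ.HasNoSources) (p : Fin k → ℕ) : 0 < Λ.rhoPow p := by
  obtain ⟨y⟩ := ‹Nonempty V›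
  have h := pathMat_mulVec_pos hfin hns H.1 p y
  rw [H.pathMat_mulVec hfin] at h
  exact pos_of_mul_pos_left h (H.1 y).le

theorem sum_eq_one (H : Λ.IsPFVector x) : ∑ y, x y = 1 := by
  rw [← H.2.1]
  exact Finset.sum_congr rfl fun y _ => (abs_of_pos (H.1 y)).symm

end IsPFVector

end Paths

end KGraph

/-! ### Existence of the Perron-Frobenius measure -/

namespace KGraph

section MeasurableSpace

variable {k : ℕ} {V : Type u} {P : Type v} {Λ : KGraph k V P}

theorem IsFinite.countable (hfin : Λ.IsFinite) : Countable P := by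
  rw [← Set.countable_univ_iff]
  have h : (Set.univ : Set P) = ⋃ p, {a | Λ.deg a = p} := by
    ext a; simp
  rw [h]
  exact Set.countable_iUnion fun p => (hfin p).countable

/-- There are countably many paths, so the cylinders form a countable subbasis. -/
theorem IsFinite.measurableSpace_eq (hfin : Λ.IsFinite) :
    (inferInstance : MeasurableSpace Λ.InfPath)
      = MeasurableSpace.generateFrom (Set.range Λ.cylinder) := by
  have := hfin.countable
  have : SecondCountableTopology Λ.InfPath := ⟨_, Set.countable_range Λ.cylinder, rfl⟩
  exact borel_eq_generateFrom_of_subbasis rfl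

theorem measurableSet_cylinder (a : P) : MeasurableSet (Λ.cylinder a) :=
  (TopologicalSpace.isOpen_generateFrom_of_mem ⟨a, rfl⟩ : IsOpen (Λ.cylinder a)).measurableSet

end MeasurableSpace

/-! ### A Markov random path driven by independent instructions, one for each time and vertex. -/

section RandomPath

variable {k : ℕ} {V : Type u} {P : Type v} {Λ : KGraph k V P}

/-- The paths of degree `(1, …, 1)` with range `y`. -/
abbrev IsFinite.Step (hfin : Λ.IsFinite) (y : V) : Type v := {a // a ∈ hfin.paths y (diag k 1)}

instance (hfin : Λ.IsFinite) (y : V) : MeasurableSpace (hfin.Step y) := ⊤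

/-- The path of degree `(n, …, n)` and range `y` that follows the instructions `ω`. -/
noncomputable def walk (hfin : Λ.IsFinite) (y : V) (ω : (i : ℕ × V) → hfin.Step i.2) : ℕ → P
  | 0 => Λ.one y
  | n + 1 => Λ.comp (walk hfin y ω n) (ω (n, Λ.src (walk hfin y ω n))).1
      (hfin.mem_paths.1 (ω (n, Λ.src (walk hfin y ω n))).2).2.symm

variable (hfin : Λ.IsFinite) (y : V) (ω : (i : ℕ × V) → hfin.Step i.2)

theorem isComp_walk (n : ℕ) : Λ.IsComp (walk hfin y ω n) (ω (n, Λ.src (walk hfin y ω n))).1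
    (walk hfin y ω (n + 1)) := ⟨_, rfl⟩

theorem deg_walk (n : ℕ) : Λ.deg (walk hfin y ω n) = diag k n := by
  induction n with
  | zero => exact Λ.deg_one y
  | succ n ih =>
    rw [(isComp_walk hfin y ω n).deg_eq, ih, (hfin.mem_paths.1 (Subtype.property _)).1]; rfl

theorem rng_walk (n : ℕ) : Λ.rng (walk hfin y ω n) = y := by
  induction n with
  | zero => exact Λ.rng_one y
  | succ n ih => rw [(isComp_walk hfin y ω n).rng_eq, ih]

/-- The infinite path with range `y` that follows the instructions `ω`. -/
noncomputable def walkInf : Λ.InfPath :=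
  (InfPath.exists_ofDiag (walk hfin y ω) (deg_walk hfin y ω)
    fun n => ⟨_, isComp_walk hfin y ω n⟩).choose

theorem init_walkInf (n : ℕ) : (walkInf hfin y ω).init (diag k n) = walk hfin y ω n :=
  (InfPath.exists_ofDiag (walk hfin y ω) (deg_walk hfin y ω)
    fun n => ⟨_, isComp_walk hfin y ω n⟩).choose_spec n

theorem preimage_walkInf_cylinder [DecidableEq P] (hfin : Λ.IsFinite) (y : V) {a : P} {n : ℕ}
    (hn : Λ.deg a ≤ diag k n) : walkInf hfin y ⁻¹' Λ.cylinder a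
      = ⋃ c ∈ (hfin.paths y (diag k n)).filter (fun c => Λ.pre c (Λ.deg a) = a),
          {ω | walk hfin y ω n = c} := by
  ext ω
  simp only [Set.mem_preimage, mem_cylinder_iff, Set.mem_iUnion, Finset.mem_filter,
    hfin.mem_paths, exists_prop]
  rw [← InfPath.pre_init _ hn, init_walkInf]
  constructor
  · intro h
    exact ⟨_, ⟨⟨deg_walk hfin y ω n, rng_walk hfin y ω n⟩, h⟩, rfl⟩
  · rintro ⟨c, ⟨-, h⟩, rfl⟩
    exact h

variable {hfin y} [Fintype V] [DecidableEq V] [Nonempty V] {x : V → ℝ}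

/-- The transition probabilities of the Perron-Frobenius random path. -/
noncomputable def IsPFVector.stepPMF (H : Λ.IsPFVector x) (hfin : Λ.IsFinite)
    (hns : Λ.HasNoSources) (y : V) : PMF (hfin.Step y) :=
  PMF.ofFintype (fun e => ENNReal.ofReal (x (Λ.src e.1) / (Λ.rhoPow (diag k 1) * x y))) (by
    have h0 := mul_pos (H.rhoPow_pos hfin hns (diag k 1)) (H.1 y)
    rw [← ENNReal.ofReal_sum_of_nonneg fun e _ => div_nonneg (H.1 _).le h0.le,
      ← Finset.sum_div, Finset.univ_eq_attach,
      Finset.sum_attach (hfin.paths y (diag k 1)) (fun a => x (Λ.src a)),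
      H.sum_paths hfin, div_self h0.ne', ENNReal.ofReal_one])

/-- The law of the instructions for the Perron-Frobenius random path. -/
noncomputable def IsPFVector.stepMeasure (H : Λ.IsPFVector x) (hfin : Λ.IsFinite)
    (hns : Λ.HasNoSources) : Measure ((i : ℕ × V) → hfin.Step i.2) :=
  Measure.infinitePi fun i => (H.stepPMF hfin hns i.2).toMeasure

instance (H : Λ.IsPFVector x) (hfin : Λ.IsFinite) (hns : Λ.HasNoSources) :
    IsProbabilityMeasure (H.stepMeasure hfin hns) := by
  unfold IsPFVector.stepMeasure; infer_instance

/-- Following `c` for `n` steps prescribes one instruction at each time, at the vertex that `c` has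
then reached. The times are distinct, so the instructions are independent, and the product of the
transition probabilities telescopes. -/
theorem IsPFVector.setOf_walk_eq (H : Λ.IsPFVector x) (hfin : Λ.IsFinite)
    (hns : Λ.HasNoSources) (y : V) (n : ℕ) : ∀ c, Λ.deg c = diag k n → Λ.rng c = y →
      ∃ (s : Finset (ℕ × V)) (t : (i : ℕ × V) → Set (hfin.Step i.2)), (∀ i ∈ s, i.1 < n) ∧
        {ω | walk hfin y ω n = c} = Set.pi s t ∧
        ∏ i ∈ s, (H.stepPMF hfin hns i.2).toMeasure (t i)
          = ENNReal.ofReal (x (Λ.src c) / (Λ.rhoPow (diag k n) * x y)) := by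
  classical
  induction n with
  | zero =>
    intro c hd hr
    obtain ⟨h1, h2⟩ := one_of_deg (a := c) hd
    refine ⟨∅, fun _ => Set.univ, by simp, ?_, ?_⟩
    · ext ω
      simp only [Finset.coe_empty, Set.empty_pi, Set.mem_univ, iff_true]
      change Λ.one y = c
      rw [h1, hr]
    · rw [Finset.prod_empty, h2, hr, show diag k 0 = 0 from rfl, rhoPow_zero, one_mul,
        div_self (H.1 y).ne', ENNReal.ofReal_one]
  | succ n ih =>
    intro c hd hr
    obtain ⟨c', e, hc', he, hc⟩ := exists_isComp (c := c) (m := diag k n) (n := diag k 1) hd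
    obtain ⟨s, t, hs, hst, hp⟩ := ih c' hc' (hc.rng_eq.symm.trans hr)
    have hem : e ∈ hfin.paths (Λ.src c') (diag k 1) :=
      hfin.mem_paths.2 ⟨he, hc.src_left.symm⟩
    let i₀ : ℕ × V := (n, Λ.src c')
    have hi₀ : i₀ ∉ s := fun h => lt_irrefl _ (hs _ h)
    let t' : (i : ℕ × V) → Set (hfin.Step i.2) := Function.update t i₀ {⟨e, hem⟩}
    have ht'₀ : t' i₀ = {⟨e, hem⟩} := Function.update_self _ _ _
    have ht' : ∀ i ∈ s, t' i = t i := fun i hi =>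
      Function.update_of_ne (fun h => hi₀ (by rwa [← h])) _ _
    refine ⟨insert i₀ s, t', fun i hi => ?_, ?_, ?_⟩
    · rcases Finset.mem_insert.1 hi with rfl | hi
      · exact Nat.lt_succ_self n
      · exact (hs i hi).trans (Nat.lt_succ_self n)
    · have h1 : Set.pi (s : Set (ℕ × V)) t' = Set.pi s t := Set.pi_congr rfl ht'
      rw [Finset.coe_insert, Set.insert_pi, h1, ← hst, ht'₀]
      ext ω
      have hw := isComp_walk hfin y ω n
      constructor
      · intro h
        have h' : walk hfin y ω (n + 1) = c := h
        rw [h'] at hw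
        obtain ⟨h2, h3⟩ := hw.inj hc ((deg_walk hfin y ω n).trans hc'.symm)
        refine ⟨?_, h2⟩
        rw [h2] at h3
        exact Subtype.ext h3
      · rintro ⟨h2, h3⟩
        have h3' : walk hfin y ω n = c' := h3
        have h2' : (ω (n, Λ.src c')).1 = e := congrArg Subtype.val h2
        rw [h3', h2'] at hw
        exact hw.unique hc
    · rw [Finset.prod_insert hi₀, Finset.prod_congr rfl (fun i hi => by rw [ht' i hi]), hp, ht'₀,
        PMF.toMeasure_apply_singleton _ _ MeasurableSpace.measurableSet_top, IsPFVector.stepPMF, PMF.ofFintype_apply,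
        ← ENNReal.ofReal_mul (div_nonneg (H.1 _).le
          (mul_pos (H.rhoPow_pos hfin hns _) (H.1 _)).le)]
      congr 1
      have h4 : Λ.rhoPow (diag k (n + 1)) = Λ.rhoPow (diag k n) * Λ.rhoPow (diag k 1) :=
        rhoPow_add (diag k n) (diag k 1)
      have h5 := (H.rhoPow_pos hfin hns (diag k n)).ne'
      have h6 := (H.rhoPow_pos hfin hns (diag k 1)).ne'
      have h7 := (H.1 y).ne'
      have h8 := (H.1 (Λ.src c')).ne'
      change x (Λ.src e) / (Λ.rhoPow (diag k 1) * x (Λ.src c')) * _ = _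
      rw [h4, hc.src_eq]
      field_simp

theorem IsPFVector.measurableSet_walk_eq (H : Λ.IsPFVector x) (hfin : Λ.IsFinite)
    (hns : Λ.HasNoSources) {y : V} {n : ℕ} {c : P} (hd : Λ.deg c = diag k n)
    (hr : Λ.rng c = y) : MeasurableSet {ω | walk hfin y ω n = c} := by
  obtain ⟨s, t, -, h, -⟩ := H.setOf_walk_eq hfin hns y n c hd hr
  rw [h]
  exact MeasurableSet.pi s.countable_toSet fun i _ => MeasurableSpace.measurableSet_top

theorem IsPFVector.stepMeasure_walk_eq (H : Λ.IsPFVector x) (hfin : Λ.IsFinite)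
    (hns : Λ.HasNoSources) {y : V} {n : ℕ} {c : P} (hd : Λ.deg c = diag k n)
    (hr : Λ.rng c = y) : H.stepMeasure hfin hns {ω | walk hfin y ω n = c}
      = ENNReal.ofReal (x (Λ.src c) / (Λ.rhoPow (diag k n) * x y)) := by
  obtain ⟨s, t, -, h, hp⟩ := H.setOf_walk_eq hfin hns y n c hd hr
  rw [h, IsPFVector.stepMeasure, Measure.infinitePi_pi _ fun i _ => MeasurableSpace.measurableSet_top, hp]

theorem IsPFVector.measurable_walkInf (H : Λ.IsPFVector x) (hfin : Λ.IsFinite)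
    (hns : Λ.HasNoSources) (y : V) : Measurable (walkInf hfin y) := by
  classical
  have h1 := hfin.measurableSpace_eq
  change Measurable[_, inferInstance] _
  rw [h1]
  refine measurable_generateFrom ?_
  rintro _ ⟨a, rfl⟩
  rw [preimage_walkInf_cylinder hfin y (le_diag _)]
  refine Finset.measurableSet_biUnion _ fun c hc => ?_
  obtain ⟨h2, h3⟩ := hfin.mem_paths.1 (Finset.mem_filter.1 hc).1
  exact H.measurableSet_walk_eq hfin hns h2 h3

/-- The walk only sees degrees `(n, …, n)`, so the cylinder is split over the extensions of `a` to
such a degree; the eigenvector equation sums them up. -/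
theorem IsPFVector.stepMeasure_cylinder (H : Λ.IsPFVector x) (hfin : Λ.IsFinite)
    (hns : Λ.HasNoSources) (a : P) :
    H.stepMeasure hfin hns (walkInf hfin (Λ.rng a) ⁻¹' Λ.cylinder a)
      = ENNReal.ofReal (x (Λ.src a) / (Λ.rhoPow (Λ.deg a) * x (Λ.rng a))) := by
  classical
  obtain ⟨q, hq⟩ := exists_add_of_le (le_diag (Λ.deg a))
  have h0 : 0 < Λ.rhoPow (diag k (Finset.univ.sup (Λ.deg a))) * x (Λ.rng a) :=
    mul_pos (H.rhoPow_pos hfin hns _) (H.1 _)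
  rw [preimage_walkInf_cylinder hfin _ (le_diag _), measure_biUnion_finset]
  · rw [Finset.sum_congr rfl fun c hc => H.stepMeasure_walk_eq hfin hns
      (hfin.mem_paths.1 (Finset.mem_filter.1 hc).1).1
      (hfin.mem_paths.1 (Finset.mem_filter.1 hc).1).2,
      ← ENNReal.ofReal_sum_of_nonneg fun c _ => div_nonneg (H.1 _).le h0.le, ← Finset.sum_div]
    rw [hq] at h0 ⊢
    rw [hfin.sum_filter_pre rfl x, H.sum_paths hfin, rhoPow_add]
    have h5 := (H.rhoPow_pos hfin hns (Λ.deg a)).ne'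
    have h6 := (H.rhoPow_pos hfin hns q).ne'
    have h7 := (H.1 (Λ.rng a)).ne'
    congr 1
    field_simp
  · intro c _ c' _ hne
    exact Set.disjoint_left.2 fun ω h h' => hne (Eq.trans (Eq.symm h) h')
  · intro c hc
    obtain ⟨h2, h3⟩ := hfin.mem_paths.1 (Finset.mem_filter.1 hc).1
    exact H.measurableSet_walk_eq hfin hns h2 h3

theorem exists_isPFMeasure (hfin : Λ.IsFinite) (hsc : Λ.IsStronglyConnected)
    (hns : Λ.HasNoSources) : ∃ M, Λ.IsPFMeasure M := by
  have H := isPFVector_pfVector hfin hsc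
  have hmeas := H.measurable_walkInf hfin hns
  -- The starting vertex is distributed according to the Perron-Frobenius vector.
  refine ⟨∑ y, ENNReal.ofReal (Λ.pfVector y) • (H.stepMeasure hfin hns).map (walkInf hfin y), ⟨?_⟩,
    fun a => ?_⟩
  · rw [Measure.finsetSum_apply]
    simp only [Measure.smul_apply, smul_eq_mul, Measure.map_apply (hmeas _) MeasurableSet.univ,
      Set.preimage_univ, measure_univ, mul_one]
    rw [← ENNReal.ofReal_sum_of_nonneg fun y _ => (H.1 y).le, H.sum_eq_one, ENNReal.ofReal_one]
  · have h5 := H.rhoPow_pos hfin hns (Λ.deg a)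
    have h7 := H.1 (Λ.rng a)
    rw [Measure.real, Measure.finsetSum_apply, Finset.sum_eq_single (Λ.rng a)]
    · rw [Measure.smul_apply, smul_eq_mul, Measure.map_apply (hmeas _) (measurableSet_cylinder a),
        H.stepMeasure_cylinder hfin hns, ← ENNReal.ofReal_mul h7.le, ENNReal.toReal_ofReal
        (mul_nonneg h7.le (div_nonneg (H.1 _).le (mul_pos h5 h7).le))]
      field_simp
    · intro y _ hy
      rw [Measure.smul_apply, Measure.map_apply (hmeas _) (measurableSet_cylinder a)]
      have h8 : walkInf hfin y ⁻¹' Λ.cylinder a = ∅ := by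
        refine Set.eq_empty_of_forall_notMem fun ω h => hy ?_
        have h9 := mem_cylinder_iff.1 h
        rw [← rng_walk hfin y ω 0, ← init_walkInf, InfPath.rng_init, ← h9, InfPath.rng_init]
      rw [h8, measure_empty, smul_zero]
    · intro h; exact absurd (Finset.mem_univ _) h

theorem isPFMeasure_pfMeasure (hfin : Λ.IsFinite) (hsc : Λ.IsStronglyConnected)
    (hns : Λ.HasNoSources) : Λ.IsPFMeasure Λ.pfMeasure := by
  have h := exists_isPFMeasure hfin hsc hns
  rw [pfMeasure, dif_pos h]
  exact h.choose_spec

end RandomPath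

end KGraph

/-! ### The Perron-Frobenius measure of closed sets -/

namespace KGraph

section ClosedSets

variable {k : ℕ} {V : Type u} {P : Type v} {Λ : KGraph k V P}

/-- The union of the cylinder sets of degree `(n, …, n)` that meet `E`. -/
def hull (n : ℕ) (E : Set Λ.InfPath) : Set Λ.InfPath :=
  {x | ∃ y ∈ E, y.init (diag k n) = x.init (diag k n)}

/-- `E` contains all limits of its elements. -/
def IsInitClosed (E : Set Λ.InfPath) : Prop := ∀ x, (∀ n, x ∈ hull n E) → x ∈ E

theorem subset_hull (n : ℕ) (E : Set Λ.InfPath) : E ⊆ hull n E := fun x hx => ⟨x, hx, rfl⟩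

theorem hull_antitone (E : Set Λ.InfPath) : Antitone fun n => hull n E := by
  rintro m n hmn x ⟨y, hy, h⟩
  refine ⟨y, hy, ?_⟩
  rw [← y.pre_init (diag_mono hmn), h, x.pre_init (diag_mono hmn)]

theorem IsInitClosed.iInter_hull {E : Set Λ.InfPath} (hE : IsInitClosed E) :
    ⋂ n, hull n E = E :=
  Set.Subset.antisymm (fun x hx => hE x (Set.mem_iInter.1 hx))
    (Set.subset_iInter fun n => subset_hull n E)

theorem IsInitClosed.of_forall_exists {E : Set Λ.InfPath}
    (h : ∀ x, x ∉ E → ∃ p : Fin k → ℕ, ∀ y ∈ E, y.init p ≠ x.init p) : IsInitClosed E := by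
  intro x hx
  by_contra hxE
  obtain ⟨p, hp⟩ := h x hxE
  obtain ⟨y, hy, hyx⟩ := hx (Finset.univ.sup p)
  refine hp y hy ?_
  rw [← y.pre_init (le_diag p), hyx, x.pre_init (le_diag p)]

open Classical in
/-- The paths of degree `(n, …, n)` whose cylinder set meets `E`. -/
noncomputable def IsFinite.meeting (hfin : Λ.IsFinite) (n : ℕ) (E : Set Λ.InfPath) : Finset P :=
  (hfin (diag k n)).toFinset.filter fun a => ∃ y ∈ E, y.init (diag k n) = a

theorem IsFinite.mem_meeting (hfin : Λ.IsFinite) {n : ℕ} {E : Set Λ.InfPath} {a : P} :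
    a ∈ hfin.meeting n E ↔ ∃ y ∈ E, y.init (diag k n) = a := by
  classical
  rw [IsFinite.meeting, Finset.mem_filter, Set.Finite.mem_toFinset, and_iff_right_iff_imp]
  rintro ⟨y, -, rfl⟩
  exact y.deg_init _

theorem IsFinite.hull_eq (hfin : Λ.IsFinite) (n : ℕ) (E : Set Λ.InfPath) :
    hull n E = {x | x.init (diag k n) ∈ hfin.meeting n E} := by
  ext x
  exact hfin.mem_meeting.symm

theorem setOf_init_mem_eq {p : Fin k → ℕ} {s : Finset P} (hs : ∀ a ∈ s, Λ.deg a = p) :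
    {x : Λ.InfPath | x.init p ∈ s} = ⋃ a ∈ s, Λ.cylinder a := by
  ext x
  simp only [Set.mem_iUnion, mem_cylinder_iff, exists_prop, Set.mem_ofPred_eq]
  constructor
  · intro h
    exact ⟨_, h, by rw [x.deg_init]⟩
  · rintro ⟨a, ha, h⟩
    rw [hs a ha] at h
    rwa [h]

theorem measurableSet_setOf_init_mem {p : Fin k → ℕ} {s : Finset P}
    (hs : ∀ a ∈ s, Λ.deg a = p) : MeasurableSet {x : Λ.InfPath | x.init p ∈ s} := by
  rw [setOf_init_mem_eq hs]
  exact Finset.measurableSet_biUnion _ fun a _ => measurableSet_cylinder a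

theorem IsFinite.deg_of_mem_meeting (hfin : Λ.IsFinite) {n : ℕ} {E : Set Λ.InfPath} {a : P}
    (ha : a ∈ hfin.meeting n E) : Λ.deg a = diag k n := by
  obtain ⟨y, -, rfl⟩ := hfin.mem_meeting.1 ha
  exact y.deg_init _

theorem IsFinite.measurableSet_hull (hfin : Λ.IsFinite) (n : ℕ) (E : Set Λ.InfPath) :
    MeasurableSet (hull n E) := by
  rw [hfin.hull_eq]
  exact measurableSet_setOf_init_mem fun a => hfin.deg_of_mem_meeting

theorem tendsto_measureReal_iInter {α : Type*} [MeasurableSpace α] (M : Measure α)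
    [IsFiniteMeasure M] {s : ℕ → Set α} (hs : ∀ n, MeasurableSet (s n)) (ha : Antitone s) :
    Tendsto (fun n => M.real (s n)) atTop (𝓝 (M.real (⋂ n, s n))) :=
  (ENNReal.tendsto_toReal (measure_ne_top _ _)).comp
    (tendsto_measure_iInter_atTop (fun n => (hs n).nullMeasurableSet) ha
      ⟨0, measure_ne_top _ _⟩)

variable [Fintype V] [DecidableEq V] {M : Measure Λ.InfPath}

namespace IsPFMeasure

theorem real_setOf_init_mem (hM : Λ.IsPFMeasure M) {p : Fin k → ℕ} {s : Finset P}
    (hs : ∀ a ∈ s, Λ.deg a = p) :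
    M.real {x | x.init p ∈ s} = ∑ a ∈ s, (Λ.rhoPow p)⁻¹ * Λ.pfVector (Λ.src a) := by
  have := hM.1
  rw [setOf_init_mem_eq hs, measureReal_biUnion_finset]
  · exact Finset.sum_congr rfl fun a ha => by rw [hM.2, hs a ha]
  · intro a ha b hb hne
    refine Set.disjoint_left.2 fun x hx hx' => hne ?_
    have h1 := mem_cylinder_iff.1 hx
    have h2 := mem_cylinder_iff.1 hx'
    rw [hs a ha] at h1
    rw [hs b hb] at h2
    exact h1.symm.trans h2
  · exact fun a _ => measurableSet_cylinder a

theorem tendsto_hull (hM : Λ.IsPFMeasure M) (hfin : Λ.IsFinite) {E : Set Λ.InfPath}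
    (hE : IsInitClosed E) : Tendsto (fun n => M.real (hull n E)) atTop (𝓝 (M.real E)) := by
  have := hM.1
  have h := tendsto_measureReal_iInter M (fun n => hfin.measurableSet_hull n E) (hull_antitone E)
  rwa [hE.iInter_hull] at h

/-- The Perron-Frobenius measure of `a E`, for a closed set `E ⊆ Z(s(a))`. -/
theorem real_setOf_shift_mem (hM : Λ.IsPFMeasure M) (hfin : Λ.IsFinite) {E : Set Λ.InfPath}
    (hE : IsInitClosed E) {a : P} (hr : ∀ y ∈ E, y.rng = Λ.src a) :
    M.real {x | x.init (Λ.deg a) = a ∧ x.shift (Λ.deg a) ∈ E}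
      = (Λ.rhoPow (Λ.deg a))⁻¹ * M.real E := by
  classical
  have := hM.1
  have : Nonempty P := ⟨a⟩
  have hcomp : ∀ n, ∀ b ∈ hfin.meeting n E, ∃ c, Λ.IsComp a b c := by
    intro n b hb
    obtain ⟨y, hy, rfl⟩ := hfin.mem_meeting.1 hb
    exact ⟨_, isComp_comp _ _ ((hr y hy).symm.trans (y.rng_init _).symm)⟩
  choose! f hf using hcomp
  have hdeg : ∀ n, ∀ c ∈ (hfin.meeting n E).image (f n), Λ.deg c = Λ.deg a + diag k n := by
    intro n c hc
    obtain ⟨b, hb, rfl⟩ := Finset.mem_image.1 hc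
    rw [(hf n b hb).deg_eq, hfin.deg_of_mem_meeting hb]
  have hset : ∀ n, {x : Λ.InfPath | x.init (Λ.deg a) = a ∧ x.shift (Λ.deg a) ∈ hull n E}
      = {x | x.init (Λ.deg a + diag k n) ∈ (hfin.meeting n E).image (f n)} := by
    intro n
    rw [hfin.hull_eq]
    ext x
    have h1 := x.isComp_init_shift (Λ.deg a) (diag k n)
    simp only [Set.mem_ofPred_eq, Finset.mem_image]
    constructor
    · rintro ⟨h2, h3⟩
      rw [h2] at h1
      exact ⟨_, h3, (hf n _ h3).unique h1⟩
    · rintro ⟨b, hb, h⟩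
      rw [← h] at h1
      obtain ⟨h2, h3⟩ := h1.inj (hf n b hb) (x.deg_init _)
      rw [h3]
      exact ⟨h2, hb⟩
  -- The approximations of `E` are finite unions of cylinders `Z(b)`, and prefixing `a` turns `Z(b)`
  -- into `Z(a b)`, where multiplicativity of `ρ(Λ)` gives the factor.
  have hreal : ∀ n, M.real {x : Λ.InfPath | x.init (Λ.deg a) = a ∧
      x.shift (Λ.deg a) ∈ hull n E} = (Λ.rhoPow (Λ.deg a))⁻¹ * M.real (hull n E) := by
    intro n
    rw [hset, hM.real_setOf_init_mem (hdeg n), Finset.sum_image, hfin.hull_eq,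
      hM.real_setOf_init_mem (fun b hb => hfin.deg_of_mem_meeting hb), Finset.mul_sum]
    · refine Finset.sum_congr rfl fun b hb => ?_
      rw [(hf n b hb).src_eq, rhoPow_add, mul_inv, mul_assoc]
    · intro b hb b' hb' h
      have h1 := hf n b' hb'
      rw [← h] at h1
      exact (hf n b hb).left_cancel h1
  have hlim := tendsto_measureReal_iInter M
    (s := fun n => {x : Λ.InfPath | x.init (Λ.deg a) = a ∧ x.shift (Λ.deg a) ∈ hull n E})
    (fun n => by rw [hset]; exact measurableSet_setOf_init_mem (hdeg n))
    (fun m n hmn x hx => ⟨hx.1, hull_antitone E hmn hx.2⟩)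
  have hinter : ⋂ n, {x : Λ.InfPath | x.init (Λ.deg a) = a ∧ x.shift (Λ.deg a) ∈ hull n E}
      = {x | x.init (Λ.deg a) = a ∧ x.shift (Λ.deg a) ∈ E} := by
    ext x
    rw [Set.mem_iInter]
    exact ⟨fun h => ⟨(h 0).1, hE _ fun n => (h n).2⟩,
      fun h n => ⟨h.1, subset_hull n E h.2⟩⟩
  rw [hinter] at hlim
  simp only [hreal] at hlim
  exact tendsto_nhds_unique hlim ((hM.tendsto_hull hfin hE).const_mul _)

theorem real_setOf_rng_eq (hM : Λ.IsPFMeasure M) (y : V) :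
    M.real {x | x.rng = y} = Λ.pfVector y := by
  have h : {x : Λ.InfPath | x.rng = y} = Λ.cylinder (Λ.one y) := by
    ext x
    rw [mem_cylinder_iff, Λ.deg_one]
    have h1 := (one_of_deg (x.deg_init 0)).1
    rw [x.rng_init] at h1
    constructor
    · rintro rfl
      exact h1
    · intro h2
      change x.rng = y
      rw [← x.rng_init 0, h2, Λ.rng_one]
  rw [h, hM.2, Λ.deg_one, rhoPow_zero, inv_one, one_mul, Λ.src_one]

variable [Nonempty V]

/-- A proper closed subset of `y Λ^∞` does not have full measure. -/
theorem real_lt_of_notMem (hM : Λ.IsPFMeasure M) (hfin : Λ.IsFinite)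
    (hsc : Λ.IsStronglyConnected) (hns : Λ.HasNoSources) {E : Set Λ.InfPath}
    (hE : IsInitClosed E) {y : V} (hr : ∀ x ∈ E, x.rng = y) {z : Λ.InfPath} (hz : z.rng = y)
    (hzE : z ∉ E) : M.real E < Λ.pfVector y := by
  have := hM.1
  have H := isPFVector_pfVector hfin hsc
  obtain ⟨n, hn⟩ : ∃ n, z ∉ hull n E := by
    by_contra hcon
    push Not at hcon
    exact hzE (hE z hcon)
  have hdisj : Disjoint E (Λ.cylinder (z.init (diag k n))) := by
    refine Set.disjoint_left.2 fun x hx hx' => hn ⟨x, hx, ?_⟩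
    have := mem_cylinder_iff.1 hx'
    rwa [z.deg_init] at this
  have hpos : 0 < M.real (Λ.cylinder (z.init (diag k n))) := by
    rw [hM.2]
    exact mul_pos (inv_pos.2 (H.rhoPow_pos hfin hns _)) (H.1 _)
  have hle : M.real (E ∪ Λ.cylinder (z.init (diag k n))) ≤ M.real {x | x.rng = y} := by
    refine measureReal_mono (Set.union_subset hr fun x hx => ?_)
    change x.rng = y
    rw [← x.rng_init, mem_cylinder_iff.1 hx, z.rng_init, hz]
  rw [measureReal_union hdisj (measurableSet_cylinder _), hM.real_setOf_rng_eq] at hle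
  linarith

/-- A closed set is null if, below each path, its tails lie in a proper closed set from a finite
collection. -/
theorem real_eq_zero (hM : Λ.IsPFMeasure M) (hfin : Λ.IsFinite)
    (hsc : Λ.IsStronglyConnected) (hns : Λ.HasNoSources) {E : Set Λ.InfPath}
    (hE : IsInitClosed E) {𝓕 : Set (Set Λ.InfPath)} (h𝓕 : 𝓕.Finite)
    (hF : ∀ y ∈ E, ∀ n, ∃ F ∈ 𝓕, IsInitClosed F ∧
      (∀ z ∈ F, z.rng = Λ.src (y.init (diag k n))) ∧
      (∃ z : Λ.InfPath, z.rng = Λ.src (y.init (diag k n)) ∧ z ∉ F) ∧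
      ∀ x ∈ E, x.init (diag k n) = y.init (diag k n) → x.shift (diag k n) ∈ F) :
    M.real E = 0 := by
  have := hM.1
  have H := isPFVector_pfVector hfin hsc
  obtain ⟨c, hc1, hc⟩ : ∃ c : ℝ, c < 1 ∧ ∀ F ∈ 𝓕, ∀ y : V,
      M.real F < Λ.pfVector y → M.real F ≤ c * Λ.pfVector y := by
    -- Only finitely many strict inequalities are involved, so one `c < 1` serves them all.
    have h1 : ∀ᶠ c in 𝓝[<] (1 : ℝ), ∀ F ∈ 𝓕, ∀ y : V,
        M.real F < Λ.pfVector y → M.real F ≤ c * Λ.pfVector y := by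
      refine (Filter.eventually_all_finite h𝓕).2 fun F _ => Filter.eventually_all.2 fun y => ?_
      by_cases h : M.real F < Λ.pfVector y
      · have h2 : Tendsto (fun c : ℝ => c * Λ.pfVector y) (𝓝[<] 1) (𝓝 (1 * Λ.pfVector y)) :=
          ((continuous_id.mul continuous_const).tendsto 1).mono_left nhdsWithin_le_nhds
        rw [one_mul] at h2
        exact (h2.eventually_const_le h).mono fun c hc _ => hc
      · exact Filter.Eventually.of_forall fun c h' => absurd h' h
    obtain ⟨c, h2, h3⟩ := (h1.and self_mem_nhdsWithin).exists
    exact ⟨c, h3, h2⟩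
  have hstep : ∀ n, M.real E ≤ c * M.real (hull n E) := by
    intro n
    have hcover : E ⊆ ⋃ a ∈ hfin.meeting n E, {x | x ∈ E ∧ x.init (diag k n) = a} := by
      intro x hx
      simp only [Set.mem_iUnion]
      exact ⟨_, hfin.mem_meeting.2 ⟨x, hx, rfl⟩, hx, rfl⟩
    have hmeas : ∀ a ∈ hfin.meeting n E, M.real {x | x ∈ E ∧ x.init (diag k n) = a}
        ≤ c * ((Λ.rhoPow (diag k n))⁻¹ * Λ.pfVector (Λ.src a)) := by
      intro a ha
      obtain ⟨y, hy, rfl⟩ := hfin.mem_meeting.1 ha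
      obtain ⟨F, hF𝓕, hFc, hFr, ⟨z, hz, hzF⟩, hFs⟩ := hF y hy n
      have h1 := hM.real_setOf_shift_mem hfin hFc hFr
      rw [y.deg_init] at h1
      have h2 := hc F hF𝓕 _ (hM.real_lt_of_notMem hfin hsc hns hFc hFr hz hzF)
      calc M.real {x | x ∈ E ∧ x.init (diag k n) = y.init (diag k n)}
          ≤ (Λ.rhoPow (diag k n))⁻¹ * M.real F := by
            rw [← h1]
            exact measureReal_mono fun x hx => ⟨hx.2, hFs x hx.1 hx.2⟩
        _ ≤ (Λ.rhoPow (diag k n))⁻¹ * (c * Λ.pfVector (Λ.src (y.init (diag k n)))) :=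
            mul_le_mul_of_nonneg_left h2 (inv_pos.2 (H.rhoPow_pos hfin hns _)).le
        _ = _ := mul_left_comm _ _ _
    calc M.real E ≤ _ := measureReal_mono hcover (measure_ne_top _ _)
      _ ≤ _ := measureReal_biUnion_finset_le _ _
      _ ≤ _ := Finset.sum_le_sum hmeas
      _ = c * M.real (hull n E) := by
        rw [← Finset.mul_sum, hfin.hull_eq,
          hM.real_setOf_init_mem (fun b hb => hfin.deg_of_mem_meeting hb)]
  have hlim : M.real E ≤ c * M.real E :=
    ge_of_tendsto' ((hM.tendsto_hull hfin hE).const_mul c) hstep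
  have h0 : 0 ≤ M.real E := measureReal_nonneg
  nlinarith

end IsPFMeasure

end ClosedSets

end KGraph

/-! ### The measure of the sets `Z(a, g, b)` -/

namespace SelfSimilarAction

variable {k : ℕ} {V : Type u} {P : Type v} [Groupoid.{w} V] {Λ : KGraph k V P}
  (S : SelfSimilarAction Λ)

/-- Initial segments of `a (g · y)` and `b y` depend only on initial segments of `y`, so any
disagreement is already visible on a finite prefix. -/
theorem isInitClosed_agreeSet (a : P) (g : GElt V) (b : P) :
    KGraph.IsInitClosed (S.agreeSet a g b) := by
  refine KGraph.IsInitClosed.of_forall_exists fun y hy => ?_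
  by_contra! hcon
  have hrng : ∀ {y' : Λ.InfPath} {p}, y'.init p = y.init p → y'.rng = y.rng := fun h => by
    rw [← KGraph.InfPath.rng_init, h, KGraph.InfPath.rng_init]
  obtain ⟨y₀, ⟨hy₀, z₀, h1, h2⟩, h3⟩ := hcon 0
  have hyg : y.rng = g.dom := (hrng h3).symm.trans hy₀
  obtain ⟨z, hz⟩ := KGraph.exists_isConcat (h2.src_eq.trans (hrng h3))
  obtain ⟨z', hz'⟩ := KGraph.exists_isConcat
    (h1.src_eq.trans ((S.rng_actInf g y₀ hy₀).trans (S.rng_actInf g y hyg).symm))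
  have hne : z' ≠ z := by
    rintro rfl
    exact hy ⟨hyg, z', hz', hz⟩
  refine hne (KGraph.InfPath.ext_init fun p => ?_)
  obtain ⟨x, ⟨hx, w, h4, h5⟩, h6⟩ := hcon p
  have h7 := KGraph.isConcat_iff.1 h4 p
  have h8 := KGraph.isConcat_iff.1 h5 p
  have h9 := KGraph.isConcat_iff.1 hz' p
  rw [S.init_actInf] at h7 h9
  simp only [h6] at h7 h8
  have h10 := h8.unique (KGraph.isConcat_iff.1 hz p)
  have h11 := h7.unique h9
  rw [← z.pre_init (le_add_self (b := Λ.deg b)), ← h10, w.pre_init le_add_self,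
    ← z'.pre_init (le_add_self (b := Λ.deg a)), ← h11, w.pre_init le_add_self]

/-- The set of those infinite paths on which `g` and `h` agree. -/
def eqSet (g h : GElt V) : Set Λ.InfPath :=
  {y | ∃ (hg : y.rng = g.dom) (hh : y.rng = h.dom), S.actInf g y hg = S.actInf h y hh}

theorem exists_init_ne_of_notMem_eqSet {g h : GElt V} {y : Λ.InfPath} (hy : y ∉ S.eqSet g h) :
    ∃ p, ∀ x ∈ S.eqSet g h, x.init p ≠ y.init p := by
  by_contra! hcon
  have hrng : ∀ {y' : Λ.InfPath} {p}, y'.init p = y.init p → y'.rng = y.rng := fun h => by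
    rw [← KGraph.InfPath.rng_init, h, KGraph.InfPath.rng_init]
  obtain ⟨y₀, ⟨hg₀, hh₀, -⟩, h0⟩ := hcon 0
  have hg := (hrng h0).symm.trans hg₀
  have hh := (hrng h0).symm.trans hh₀
  refine hy ⟨hg, hh, KGraph.InfPath.ext_init fun p => ?_⟩
  obtain ⟨x, ⟨hgx, hhx, h1⟩, h2⟩ := hcon p
  have h3 := congrArg (fun z => z.init p) h1
  rw [S.init_actInf, S.init_actInf] at h3 ⊢
  simp only [h2] at h3
  exact h3

/-- The set of those `m ∈ Λ^{lN}` with `g · m = h · m` and `g|_m = h|_m`. -/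
def agreeing (g h : GElt V) (l : ℕ) : Set P :=
  {m | Λ.deg m = KGraph.diag k l ∧ ∃ (hg : Λ.rng m = g.dom) (hh : Λ.rng m = h.dom),
    S.smul g m hg = S.smul h m hh ∧ S.restr g m hg = S.restr h m hh}

/-- Equal values and equal restrictions on a path force the same on all its extensions. -/
theorem init_mem_agreeing_mono {g h : GElt V} {y : Λ.InfPath} {m n : ℕ} (hmn : m ≤ n)
    (hm : y.init (KGraph.diag k m) ∈ S.agreeing g h m) :
    y.init (KGraph.diag k n) ∈ S.agreeing g h n := by
  obtain ⟨-, hg, hh, h1, h2⟩ := hm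
  have hc := y.isComp_init_seg (KGraph.diag_mono (k := k) hmn)
  obtain ⟨hs, hc'⟩ := hc
  refine ⟨y.deg_init _, (y.rng_init _).trans ((y.rng_init _).symm.trans hg),
    (y.rng_init _).trans ((y.rng_init _).symm.trans hh), ?_, ?_⟩
  · simp only [← hc', S.smul_comp _ _ _ hg hs, S.smul_comp _ _ _ hh hs, h1, h2]
  · simp only [← hc', S.restr_comp _ _ _ hg hs, S.restr_comp _ _ _ hh hs, h2]

theorem mem_eqSet_of_init_mem_agreeing {g h : GElt V} {y : Λ.InfPath} {n : ℕ}
    (hn : y.init (KGraph.diag k n) ∈ S.agreeing g h n) : y ∈ S.eqSet g h := by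
  have hg : y.rng = g.dom := (y.rng_init _).symm.trans hn.2.1
  have hh : y.rng = h.dom := (y.rng_init _).symm.trans hn.2.2.1
  refine ⟨hg, hh, KGraph.InfPath.ext_init_diag fun l => ?_⟩
  rw [← (S.actInf g y hg).pre_init (KGraph.diag_mono (le_max_left l n)),
    ← (S.actInf h y hh).pre_init (KGraph.diag_mono (le_max_left l n)), S.init_actInf,
    S.init_actInf]
  obtain ⟨-, _, _, h1, -⟩ := S.init_mem_agreeing_mono (le_max_right l n) hn
  rw [h1]

theorem agreeSet_eq_of_isPeriodPair {a b : P} {h : GElt V}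
    (hd : h.dom = Λ.src b) (hp : S.IsPeriodPair (Λ.deg b) a (b, h)) :
    S.agreeSet a h b = {y | y.rng = Λ.src b} := by
  ext y
  exact ⟨fun hy => hy.1.trans hd, fun hy => (S.isPeriodPair_iff.1 hp).2 y
    ((show y.rng = Λ.src b from hy).trans hd.symm)⟩

theorem agreeSet_eq_eqSet {a b : P} {g h : GElt V} (hgh : g.dom = h.dom)
    (hp : S.IsPeriodPair (Λ.deg b) a (b, h)) : S.agreeSet a g b = S.eqSet g h := by
  ext y
  constructor
  · rintro ⟨hy, z, h1, h2⟩
    obtain ⟨_, z', h3, h4⟩ := (S.isPeriodPair_iff.1 hp).2 y (hy.trans hgh)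
    refine ⟨hy, hy.trans hgh, ?_⟩
    rw [← h1.shift_eq, ← h3.shift_eq, h2.unique h4]
  · rintro ⟨hg, hh, h1⟩
    obtain ⟨_, z, h3, h4⟩ := (S.isPeriodPair_iff.1 hp).2 y hh
    exact ⟨hg, z, h1 ▸ h3, h4⟩

section Measure

variable [Fintype V] [DecidableEq V] {M : Measure Λ.InfPath}

theorem real_zSet (hM : Λ.IsPFMeasure M) (hfin : Λ.IsFinite) {a b : P} {g : GElt V}
    (hdom : g.dom = Λ.src b) :
    M.real (S.zSet a g b) = (Λ.rhoPow (Λ.deg b))⁻¹ * M.real (S.agreeSet a g b) := by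
  rw [← hM.real_setOf_shift_mem hfin (S.isInitClosed_agreeSet a g b)
    fun y hy => hy.1.trans hdom]
  congr 1
  ext x
  exact S.mem_zSet_iff

theorem real_agreeSet_of_notMem_per [Nonempty V] (hM : Λ.IsPFMeasure M) (hfin : Λ.IsFinite)
    (hsc : Λ.IsStronglyConnected) (hns : Λ.HasNoSources) (hfs : S.IsFiniteState)
    {a b : P} {g : GElt V} (hdom : g.dom = Λ.src b) (hcod : g.cod = Λ.src a)
    (H : (fun i => (Λ.deg a i : ℤ) - (Λ.deg b i : ℤ)) ∉ S.per) :
    M.real (S.agreeSet a g b) = 0 := by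
  refine hM.real_eq_zero hfin hsc hns (S.isInitClosed_agreeSet a g b)
    -- Finite because the degrees of the two outer paths are fixed and the middle entry is a
    -- restriction of `g`.
    (𝓕 := (fun t : P × GElt V × P => S.agreeSet t.1 t.2.1 t.2.2) ''
      ({a' | Λ.deg a' = Λ.deg a} ×ˢ {h | ∃ c hc, S.restr g c hc = h} ×ˢ
        {b' | Λ.deg b' = Λ.deg b}))
    (((hfin _).prod ((hfs.finite_restr S g).prod (hfin _))).image _) ?_
  rintro y ⟨hy, -⟩ n
  obtain ⟨a', b', ha', hb', hs, hsub⟩ := S.exists_shift_mem_agreeSet (n := KGraph.diag k n)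
    hy (hdom.symm.trans hy.symm) hcod.symm
  refine ⟨_, ⟨(a', _, b'), ⟨ha', ⟨_, _, rfl⟩, hb'⟩, rfl⟩, S.isInitClosed_agreeSet _ _ _,
    fun z hz => hz.1.trans (S.dom_restr _ _ _), ?_, hsub⟩
  -- A full tail set would make `(b', g|_v)` a period pair of `a'`, so that `d(a') - d(b') = d(a) -
  -- d(b)` would be a period.
  by_contra! hcon
  refine H ?_
  have hp := (S.isPeriodPair_iff (a := a') (b := b')).2
    ⟨hb', fun x hx => hcon x (hx.trans (S.dom_restr _ _ _))⟩
  rw [← ha']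
  exact hp.mem_per S

/-- Almost every infinite path on which `g` and `h` agree has an initial segment on which `g` and
`h` have the same values and the same restrictions. -/
theorem real_eqSet_diff [Nonempty V] (hM : Λ.IsPFMeasure M) (hfin : Λ.IsFinite)
    (hsc : Λ.IsStronglyConnected) (hns : Λ.HasNoSources) (hfs : S.IsFiniteState)
    (g h : GElt V) :
    M.real {y | y ∈ S.eqSet g h ∧ ∀ n, y.init (KGraph.diag k n) ∉ S.agreeing g h n} = 0 := by
  refine hM.real_eq_zero hfin hsc hns ?_
    (𝓕 := (fun t : GElt V × GElt V => S.eqSet t.1 t.2) ''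
      ({g' | ∃ c hc, S.restr g c hc = g'} ×ˢ {h' | ∃ c hc, S.restr h c hc = h'}))
    (((hfs.finite_restr S g).prod (hfs.finite_restr S h)).image _) ?_
  · refine KGraph.IsInitClosed.of_forall_exists fun y hy => ?_
    by_cases hyE : y ∈ S.eqSet g h
    · obtain ⟨n, hn⟩ : ∃ n, y.init (KGraph.diag k n) ∈ S.agreeing g h n := by
        by_contra! hcon
        exact hy ⟨hyE, hcon⟩
      exact ⟨_, fun x hx hxy => hx.2 n (hxy ▸ hn)⟩
    · obtain ⟨p, hp⟩ := S.exists_init_ne_of_notMem_eqSet hyE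
      exact ⟨p, fun x hx => hp x hx.1⟩
  · rintro y ⟨⟨hg, hh, hgh⟩, hyn⟩ n
    have hgr : Λ.rng (y.init (KGraph.diag k n)) = g.dom := (y.rng_init _).trans hg
    have hhr : Λ.rng (y.init (KGraph.diag k n)) = h.dom := (y.rng_init _).trans hh
    have hsm : S.smul g _ hgr = S.smul h _ hhr := by
      have := congrArg (fun z => z.init (KGraph.diag k n)) hgh
      rwa [S.init_actInf, S.init_actInf] at this
    refine ⟨_, ⟨(S.restr g _ hgr, S.restr h _ hhr), ⟨⟨_, _, rfl⟩, ⟨_, _, rfl⟩⟩, rfl⟩,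
      KGraph.IsInitClosed.of_forall_exists fun z hz => S.exists_init_ne_of_notMem_eqSet hz,
      fun z hz => hz.1.trans (S.dom_restr _ _ _), ?_, ?_⟩
    -- If the two restrictions agreed on every infinite path they would be equal, and the initial
    -- segment of `y` would be agreeing.
    · by_contra! hcon
      refine hyn n ⟨y.deg_init _, hgr, hhr, hsm, ?_⟩
      refine S.ext_of_actInf hns ((S.dom_restr _ _ _).trans (S.dom_restr _ _ _).symm)
        (by rw [S.cod_restr, S.cod_restr, hsm]) fun x hx => ?_
      exact (hcon x (hx.trans (S.dom_restr _ _ _))).2.2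
    · rintro x ⟨⟨hgx, hhx, hx⟩, -⟩ hxy
      have hxc : KGraph.IsConcat (y.init (KGraph.diag k n)) (x.shift (KGraph.diag k n)) x := by
        have := KGraph.IsConcat.of_init (a := y.init (KGraph.diag k n)) x
          (by rw [y.deg_init, hxy])
        rwa [y.deg_init] at this
      have hd := hxc.src_eq.symm
      have h1 := S.isConcat_actInf hxc hgr (hd.trans (S.dom_restr _ _ _).symm) hgx
      have h2 := S.isConcat_actInf hxc hhr (hd.trans (S.dom_restr _ _ _).symm) hhx
      refine ⟨hd.trans (S.dom_restr _ _ _).symm, hd.trans (S.dom_restr _ _ _).symm, ?_⟩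
      dsimp only
      rw [← h1.shift_eq, ← h2.shift_eq, hx, hsm]

-- Grouping the agreeing paths of degree `lN` by source turns the total measure of their disjoint
-- cylinders into the defining sum.
open Classical in
theorem cSeq_eq (hM : Λ.IsPFMeasure M) (hfin : Λ.IsFinite) (q : Fin k → ℕ) (a : P)
    (g : GElt V) (l : ℕ) : S.cSeq q a g l
      = M.real {y | y.init (KGraph.diag k l) ∈
          (hfin (KGraph.diag k l)).toFinset.filter (· ∈ S.agreeing g (S.hElt q a) l)} := by
  rw [hM.real_setOf_init_mem fun m hm => (Finset.mem_filter.1 hm).2.1, ← Finset.mul_sum,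
    ← Finset.sum_fiberwise_of_maps_to (g := Λ.src) (t := Finset.univ)
      (fun _ _ => Finset.mem_univ _)]
  refine congrArg (_ * ·) (Finset.sum_congr rfl fun x _ => ?_)
  rw [Finset.sum_congr rfl (g := fun _ => Λ.pfVector x)
    (fun a ha => by rw [(Finset.mem_filter.1 ha).2]), Finset.sum_const, nsmul_eq_mul,
    ← Set.ncard_coe_finset]
  refine congrArg (fun s : Set P => (s.ncard : ℝ) * Λ.pfVector x) ?_
  ext m
  simp only [Finset.coe_filter]
  refine Iff.trans ?_ (and_congr_left' Finset.mem_filter).symm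
  rw [Set.Finite.mem_toFinset]
  exact ⟨fun ⟨h1, h2, h3⟩ => ⟨⟨h1, h1, h3⟩, h2⟩, fun ⟨⟨h1, _, h3⟩, h2⟩ => ⟨h1, h2, h3⟩⟩

theorem tendsto_cSeq [Nonempty V] (hM : Λ.IsPFMeasure M) (hfin : Λ.IsFinite)
    (hsc : Λ.IsStronglyConnected) (hns : Λ.HasNoSources) (hfs : S.IsFiniteState)
    (q : Fin k → ℕ) (a : P) (g : GElt V) :
    Tendsto (S.cSeq q a g) atTop (𝓝 (M.real (S.eqSet g (S.hElt q a)))) := by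
  classical
  have := hM.1
  set h := S.hElt q a with hh
  let U : ℕ → Set Λ.InfPath := fun n => {y | y.init (KGraph.diag k n) ∈
    (hfin (KGraph.diag k n)).toFinset.filter (· ∈ S.agreeing g h n)}
  have hU : ∀ n y, y ∈ U n ↔ y.init (KGraph.diag k n) ∈ S.agreeing g h n := fun n y => by
    simp only [U, Set.mem_ofPred_eq, Finset.mem_filter, Set.Finite.mem_toFinset]
    exact and_iff_right (y.deg_init _)
  have hmono : Monotone U := fun m n hmn y hy =>
    (hU n y).2 (S.init_mem_agreeing_mono hmn ((hU m y).1 hy))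
  have hlim : Tendsto (fun n => M.real (U n)) atTop (𝓝 (M.real (⋃ n, U n))) :=
    (ENNReal.tendsto_toReal (measure_ne_top _ _)).comp (tendsto_measure_iUnion_atTop hmono)
  have hE : M.real (S.eqSet g h) = M.real (⋃ n, U n) := by
    refine le_antisymm ?_ (measureReal_mono (Set.iUnion_subset fun n y hy =>
      S.mem_eqSet_of_init_mem_agreeing ((hU n y).1 hy)))
    have hsub : S.eqSet g h ⊆ (⋃ n, U n) ∪
        {y | y ∈ S.eqSet g h ∧ ∀ n, y.init (KGraph.diag k n) ∉ S.agreeing g h n} := by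
      intro y hy
      by_cases hy' : ∃ n, y ∈ U n
      · exact Or.inl (Set.mem_iUnion.2 hy')
      · refine Or.inr ⟨hy, fun n hn => hy' ⟨n, (hU n y).2 hn⟩⟩
    refine (measureReal_mono hsub).trans ((measureReal_union_le _ _).trans ?_)
    rw [S.real_eqSet_diff hM hfin hsc hns hfs g h, add_zero]
  rw [hE]
  exact hlim.congr fun n => (S.cSeq_eq hM hfin q a g n).symm

end Measure

end SelfSimilarAction

theorem mainTheorem5 {k : ℕ} (hk : 1 ≤ k) {V : Type u} {P : Type v} [Fintype V] [DecidableEq V]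
    [Groupoid.{w} V] (Λ : KGraph k V P) (hfin : Λ.IsFinite) (hsc : Λ.IsStronglyConnected)
    (hns : Λ.HasNoSources) (S : SelfSimilarAction Λ) (hfs : S.IsFiniteState)
    (a b : P) (g : GElt V) (hdom : g.dom = Λ.src b) (hcod : g.cod = Λ.src a) :
    ((fun i => (Λ.deg a i : ℤ) - (Λ.deg b i : ℤ)) ∈ S.per → b = S.theta (Λ.deg b) a →
        g = S.hElt (Λ.deg b) a →
        Λ.pfMeasure.real (S.zSet a g b) = (Λ.rhoPow (Λ.deg b))⁻¹ * Λ.pfVector (Λ.src b)) ∧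
    ((fun i => (Λ.deg a i : ℤ) - (Λ.deg b i : ℤ)) ∈ S.per → b = S.theta (Λ.deg b) a →
        g ≠ S.hElt (Λ.deg b) a →
        Tendsto (S.cSeq (Λ.deg b) a g) atTop (𝓝 (S.cLim (Λ.deg b) a g)) ∧
        Λ.pfMeasure.real (S.zSet a g b)
          = (Λ.rhoPow (Λ.deg b))⁻¹ * S.cLim (Λ.deg b) a g) ∧
    (¬ ((fun i => (Λ.deg a i : ℤ) - (Λ.deg b i : ℤ)) ∈ S.per ∧ b = S.theta (Λ.deg b) a) →
        Λ.pfMeasure.real (S.zSet a g b) = 0) := by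

  have : Nonempty V := ⟨Λ.src b⟩
  have hM := KGraph.isPFMeasure_pfMeasure hfin hsc hns
  rw [S.real_zSet hM hfin hdom]
  refine ⟨fun hper hb hg => ?_, fun hper hb hg => ?_, fun H => ?_⟩
  · have hp := S.periodPair_spec hns hsc hper
    rw [← hb, ← hg] at hp
    rw [S.agreeSet_eq_of_isPeriodPair hdom hp, hM.real_setOf_rng_eq]
  · have hp := S.periodPair_spec hns hsc hper
    rw [← hb] at hp
    have hlim := S.tendsto_cSeq hM hfin hsc hns hfs (Λ.deg b) a g
    rw [← S.agreeSet_eq_eqSet (hdom.trans (hp.dom_eq S hns).symm) hp] at hlim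
    -- `cLim` is meaningful because convergence is already known, with limit the measure of the set.
    have hc : S.cLim (Λ.deg b) a g = _ := hlim.limUnder_eq
    rw [hc]
    exact ⟨hlim, rfl⟩
  · by_cases hper : (fun i => (Λ.deg a i : ℤ) - (Λ.deg b i : ℤ)) ∈ S.per
    · have hempty : S.agreeSet a g b = ∅ := by
        by_contra hne
        exact H ⟨hper, S.eq_theta_of_nonempty hns hsc hper (Set.nonempty_iff_ne_empty.2 hne)⟩
      rw [hempty, measureReal_empty, mul_zero]
    · rw [S.real_agreeSet_of_notMem_per hM hfin hsc hns hfs hdom hcod hper, mul_zero]
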